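/- Let $G$ be a compact (Hausdorff) group with normalized Haar measure $\lambda$ and let $\Phi:\mathbb R\to[0,\infty)$ be an $N$-function, i.e. $\Phi$ is convex and even, $\Phi(0)=0$, $\lim_{x\to0}\Phi(x)/x=0$ and $\lim_{x\to\infty}\Phi(x)/x=\infty$. Let $\Psi(y)=\sup\{x|y|-\Phi(x):x\ge 0\}$ be the complementary function. For measurable $f:G\to\mathbb C$ put $\rho_\Phi(f)=\int_G\Phi(|f|)\,d\lambda$ and $N_\Phi(f)=\inf\{k>0:\rho_\Phi(f/k)\le1\}$ (with $\inf\emptyset=\infty$), and let $M^\Phi(G)$ be the space of measurable $f$ (modulo equality almost everywhere) with $\rho_\Phi(af)<\infty$ for all $a>0$; define $M^\Psi(G)$ likewise. Put $\|g\|_\Psi=\sup\{\int_G|gh|\,d\lambda: h \text{ measurable},\ N_\Phi(h)\le1\}$. Write $(f*g)(x)=\int_G f(y)g(y^{-1}x)\,d\lambda(y)$ and $\check g(x)=g(x^{-1})$. Let $A_\Phi(G)$ be the set of those $u\in C_0(G)=C(G)$ for which there are sequences $(f_n)$ in $M^\Phi(G)$ and $(g_n)$ in $M^\Psi(G)$ with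 $\sum_n N_\Phi(f_n)\|g_n\|_\Psi<\infty$ and $u=\sum_n f_n*\check g_n$, and let $\|u\|_{A_\Phi}$ be the infimum of $\sum_n N_\Phi(f_n)\|g_n\|_\Psi$ over all such representations. Then $(A_\Phi(G),\|\cdot\|_{A_\Phi})$, regarded as a subset of $L^1(G)$, is a symmetric Segal algebra in $L^1(G)$, that is: 1. $A_\Phi(G)$ is a dense linear subspace of $L^1(G)$; 2. $(A_\Phi(G),\|\cdot\|_{A_\Phi})$ is a Banach space, and $\|u\|_1\le\|u\|_{A_\Phi}$ for all $u\in A_\Phi(G)$; 3. for all $u\in A_\Phi(G)$ and $t\in G$ the translates $\mathcal L_tu(x)=u(t^{-1}x)$ and $\mathcal R_tu(x)=u(xt)$ belong to $A_\Phi(G)$; 4. for every $u\in A_\Phi(G)$ the maps $t\mapsto\mathcal L_tu$ and $t\mapsto\mathcal R_tu$ from $G$ to $(A_\Phi(G),\|\cdot\|_{A_\Phi})$ are continuous. In particular, $(A_\Phi(G),\|\cdot\|_{A_\Phi})$ is an abstract Segal algebra with respect to the Banach algebra $(L^1(G),*)$, that is: $A_\Phi(G)$ is a dense left ideal of $L^1(G)$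 and a Banach algebra for $*$ and $\|\cdot\|_{A_\Phi}$, and there are constants $M,C>0$ such that $\|u\|_1\le M\|u\|_{A_\Phi}$ and $\|f*u\|_{A_\Phi}\le C\,\|f\|_1\|u\|_{A_\Phi}$ for all $f\in L^1(G)$ and $u\in A_\Phi(G)$. -/

import Mathlib

open MeasureTheory Filter Topology
open scoped ENNReal ZeroAtInfty

/-- An `N`-function: a convex even function `Φ : ℝ → [0, ∞)` with `Φ 0 = 0`,
`Φ x / x → 0` as `x → 0` and `Φ x / x → ∞` as `x → ∞`. -/
structure IsNFunction (Φ : ℝ → ℝ) : Prop where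
  nonneg : ∀ x, 0 ≤ Φ x
  convex : ConvexOn ℝ Set.univ Φ
  even : ∀ x, Φ (-x) = Φ x
  map_zero : Φ 0 = 0
  tendsto_zero : Tendsto (fun x => Φ x / x) (𝓝[≠] 0) (𝓝 0)
  tendsto_top : Tendsto (fun x => Φ x / x) atTop atTop

/-- The complementary function `Ψ y = sup {x |y| - Φ x : x ≥ 0}`.  For an `N`-function `Φ` the set
is nonempty and bounded above, so this is an honest supremum of real numbers. -/
noncomputable def complementary (Φ : ℝ → ℝ) (y : ℝ) : ℝ :=
  sSup ((fun x => x * |y| - Φ x) '' Set.Ici 0)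

section Orlicz

variable {G : Type*} [MeasurableSpace G]

/-- The modular `ρ_Φ(f) = ∫ Φ(|f|) dμ`, with values in `[0, ∞]`. -/
noncomputable def modular (Φ : ℝ → ℝ) (μ : Measure G) (f : G → ℂ) : ℝ≥0∞ :=
  ∫⁻ x, ENNReal.ofReal (Φ ‖f x‖) ∂μ

/-- `f` represents an element of the Morse-Transue space `M^Φ`: it is `μ`-measurable and
`ρ_Φ(a f) < ∞` for all `a > 0`. -/
def MemMorseTransue (Φ : ℝ → ℝ) (μ : Measure G) (f : G → ℂ) : Prop :=
  AEStronglyMeasurable f μ ∧ ∀ a : ℝ, 0 < a → modular Φ μ (fun x => (a : ℂ) * f x) < ∞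

/-- The Luxemburg-Nakano norm `N_Φ(f) = inf {k > 0 : ρ_Φ(f / k) ≤ 1}`, with values in `[0, ∞]`
(it is `∞` if there is no such `k`). -/
noncomputable def luxemburgNorm (Φ : ℝ → ℝ) (μ : Measure G) (f : G → ℂ) : ℝ≥0∞ :=
  ⨅ (k : ℝ) (_ : 0 < k) (_ : modular Φ μ (fun x => f x / (k : ℂ)) ≤ 1), ENNReal.ofReal k

/-- For a complementary pair `(Φ, Ψ)`, the Orlicz norm
`‖g‖_Ψ = sup {∫ |g h| dμ : h measurable, N_Φ(h) ≤ 1}`, with values in `[0, ∞]`.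
The first argument is the function `Φ` complementary to `Ψ`. -/
noncomputable def complementaryOrliczNorm (Φ : ℝ → ℝ) (μ : Measure G) (g : G → ℂ) : ℝ≥0∞ :=
  ⨆ (h : G → ℂ) (_ : AEStronglyMeasurable h μ) (_ : luxemburgNorm Φ μ h ≤ 1),
    ∫⁻ x, ‖g x * h x‖ₑ ∂μ

end Orlicz

section FigaTalamancaHerzOrlicz

variable {G : Type*} [Group G] [MeasurableSpace G]

/-- The convolution `(f * g)(x) = ∫ f(y) g(y⁻¹ x) dμ(y)`. -/
noncomputable def groupConv (μ : Measure G) (f g : G → ℂ) (x : G) : ℂ :=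
  ∫ y, f y * g (y⁻¹ * x) ∂μ

/-- The total cost `∑ N_Φ(fₙ) ‖gₙ‖_Ψ` of a pair of sequences, where `Ψ` is complementary
to `Φ`. -/
noncomputable def seriesCost (Φ : ℝ → ℝ) (μ : Measure G) (f g : ℕ → G → ℂ) : ℝ≥0∞ :=
  ∑' n, luxemburgNorm Φ μ (f n) * complementaryOrliczNorm Φ μ (g n)

/-- The sequences `f` in `M^Φ` and `g` in `M^Ψ`, `Ψ` complementary to `Φ`, represent `u`:
`∑ N_Φ(fₙ) ‖gₙ‖_Ψ < ∞` and `u = ∑ fₙ * ǧₙ`, where `ǧ(x) = g(x⁻¹)`. -/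
structure IsRepresentation (Φ : ℝ → ℝ) (μ : Measure G) (u : G → ℂ) (f g : ℕ → G → ℂ) :
    Prop where
  mem_left : ∀ n, MemMorseTransue Φ μ (f n)
  mem_right : ∀ n, MemMorseTransue (complementary Φ) μ (g n)
  cost_lt_top : seriesCost Φ μ f g < ∞
  hasSum : ∀ x, HasSum (fun n => groupConv μ (f n) (fun z => g n z⁻¹) x) (u x)

variable [TopologicalSpace G]

/-- The space `A_Φ(G)`: those `u ∈ C₀(G)` that have a representation `u = ∑ fₙ * ǧₙ`. -/
def figaHerzOrlicz (Φ : ℝ → ℝ) (μ : Measure G) : Set C₀(G, ℂ) :=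
  {u | ∃ f g : ℕ → G → ℂ, IsRepresentation Φ μ u f g}

/-- The norm of `A_Φ(G)`: the infimum of `∑ N_Φ(fₙ) ‖gₙ‖_Ψ` over all representations, finite on
`A_Φ(G)`. -/
noncomputable def figaHerzOrliczNorm (Φ : ℝ → ℝ) (μ : Measure G) (u : C₀(G, ℂ)) : ℝ≥0∞ :=
  ⨅ (f : ℕ → G → ℂ) (g : ℕ → G → ℂ) (_ : IsRepresentation Φ μ u f g), seriesCost Φ μ f g

/-- `A_Φ(G)` as a subset of `L¹(G)`: the classes of the functions in `A_Φ(G)`. -/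
def figaHerzOrliczL1 (Φ : ℝ → ℝ) (μ : Measure G) : Set (Lp ℂ 1 μ) :=
  {v | ∃ u ∈ figaHerzOrlicz Φ μ, v =ᵐ[μ] u}

/-- The norm of `A_Φ(G)` on classes.  When `μ` is positive on nonempty open sets (as a Haar measure
is), a class has at most one continuous representative `u`, and the value is `‖u‖_{A_Φ}`. -/
noncomputable def figaHerzOrliczL1Norm (Φ : ℝ → ℝ) (μ : Measure G) (v : Lp ℂ 1 μ) : ℝ :=
  (⨅ (u : C₀(G, ℂ)) (_ : u ∈ figaHerzOrlicz Φ μ) (_ : v =ᵐ[μ] u),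
    figaHerzOrliczNorm Φ μ u).toReal

end FigaTalamancaHerzOrlicz

/-- `S` is a linear subspace of `A` and `N`, restricted to `S`, is a norm for which `S` is
a Banach space. -/
structure IsBanachSubspace {A : Type*} [AddCommGroup A] [Module ℂ A] (S : Set A) (N : A → ℝ) :
    Prop where
  zero_mem : (0 : A) ∈ S
  add_mem : ∀ a ∈ S, ∀ b ∈ S, a + b ∈ S
  smul_mem : ∀ (c : ℂ), ∀ a ∈ S, c • a ∈ S
  norm_nonneg : ∀ a ∈ S, 0 ≤ N a
  norm_eq_zero : ∀ a ∈ S, (N a = 0 ↔ a = 0)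
  norm_add_le : ∀ a ∈ S, ∀ b ∈ S, N (a + b) ≤ N a + N b
  norm_smul : ∀ (c : ℂ), ∀ a ∈ S, N (c • a) = ‖c‖ * N a
  complete : ∀ a : ℕ → A, (∀ n, a n ∈ S) →
    (∀ ε : ℝ, 0 < ε → ∃ n₀, ∀ m ≥ n₀, ∀ n ≥ n₀, N (a m - a n) < ε) →
    ∃ b ∈ S, Tendsto (fun n => N (a n - b)) atTop (𝓝 0)

section Segal

variable {G : Type*} [Group G] [TopologicalSpace G] [MeasurableSpace G]

/-- `S`, with the norm `N`, is a Segal algebra in `L¹(G)`.  In the last field `Γ t` is the left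
translate `x ↦ v (t⁻¹ x)` of `v`, and `t ↦ Γ t` is continuous from `G` to `(S, N)`. -/
structure IsSegalAlgebra (μ : Measure G) (S : Set (Lp ℂ 1 μ)) (N : Lp ℂ 1 μ → ℝ) : Prop where
  dense : Dense S
  banach : IsBanachSubspace S N
  norm_le : ∀ v ∈ S, ‖v‖ ≤ N v
  left_translation : ∀ v ∈ S, ∃ Γ : G → Lp ℂ 1 μ,
    (∀ t, Γ t ∈ S ∧ Γ t =ᵐ[μ] fun x => v (t⁻¹ * x)) ∧
    ∀ s, Tendsto (fun t => N (Γ t - Γ s)) (𝓝 s) (𝓝 0)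

/-- `S`, with the norm `N`, is a symmetric Segal algebra in `L¹(G)`.  In the last field `Λ t` is
the right translate `x ↦ v (x t)` of `v`. -/
structure IsSymmetricSegalAlgebra (μ : Measure G) (S : Set (Lp ℂ 1 μ)) (N : Lp ℂ 1 μ → ℝ) :
    Prop extends IsSegalAlgebra μ S N where
  right_translation : ∀ v ∈ S, ∃ Λ : G → Lp ℂ 1 μ,
    (∀ t, Λ t ∈ S ∧ Λ t =ᵐ[μ] fun x => v (x * t)) ∧
    ∀ s, Tendsto (fun t => N (Λ t - Λ s)) (𝓝 s) (𝓝 0)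

end Segal

/-- `h ∈ L¹(G)` is the convolution of `f, g ∈ L¹(G)`: for almost every `x` the function
`y ↦ f(y) g(y⁻¹ x)` is integrable, with integral `h(x)`. -/
def IsL1Convolution {G : Type*} [Group G] [MeasurableSpace G] (μ : Measure G)
    (f g h : Lp ℂ 1 μ) : Prop :=
  ∀ᵐ x ∂μ, Integrable (fun y => f y * g (y⁻¹ * x)) μ ∧ h x = groupConv μ f g x

/-- The operation `mul` makes the normed space `A` a normed algebra (a Banach algebra if `A` is
complete, as `L¹` is). -/
structure IsNormedAlgebraProduct {A : Type*} [NormedAddCommGroup A] [NormedSpace ℂ A]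
    (mul : A → A → A) : Prop where
  add_left : ∀ a b c, mul (a + b) c = mul a c + mul b c
  add_right : ∀ a b c, mul a (b + c) = mul a b + mul a c
  smul_left : ∀ (z : ℂ) (a b), mul (z • a) b = z • mul a b
  smul_right : ∀ (z : ℂ) (a b), mul a (z • b) = z • mul a b
  assoc : ∀ a b c, mul (mul a b) c = mul a (mul b c)
  norm_le : ∀ a b, ‖mul a b‖ ≤ ‖a‖ * ‖b‖

/-- `S`, with the norm `N`, is an abstract Segal algebra with respect to the Banach algebra `A`
with product `mul`: it is a dense left ideal of `A` and a Banach algebra for `N`, its norm dominates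
the norm of `A` up to a constant, and `N (a b) ≤ C ‖a‖ N b`. -/
structure IsAbstractSegalAlgebra {A : Type*} [NormedAddCommGroup A] [NormedSpace ℂ A]
    (mul : A → A → A) (S : Set A) (N : A → ℝ) : Prop where
  product : IsNormedAlgebraProduct mul
  complete : CompleteSpace A
  dense : Dense S
  banach : IsBanachSubspace S N
  mul_mem : ∀ a, ∀ b ∈ S, mul a b ∈ S
  norm_mul_le : ∀ a ∈ S, ∀ b ∈ S, N (mul a b) ≤ N a * N b
  norm_le : ∃ M : ℝ, 0 < M ∧ ∀ b ∈ S, ‖b‖ ≤ M * N b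
  norm_mul_le' : ∃ C : ℝ, 0 < C ∧ ∀ a, ∀ b ∈ S, N (mul a b) ≤ C * ‖a‖ * N b

/-!
# `A_Φ(G)` is a symmetric Segal algebra

By Hölder's inequality `‖u‖_∞ ≤ ‖u‖_{A_Φ}`, and almost optimal representations of the terms of an
absolutely convergent series in `A_Φ(G)` combine to one of its sum (`figaHerzOrlicz_hasSum`).  So
`A_Φ(G)`, built here as the type `FigaHerzOrliczSpace`, is a Banach space of continuous functions.

Translating `u = ∑ fₙ * ǧₙ` on the left translates the `fₙ`, and translating it on the right
translates the `gₙ`; neither changes the cost of the representation.  Translation is continuous on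
`M^Φ` and on `M^Ψ`, because after truncation the modular is controlled by the `L¹` norm
(`MemMorseTransue.tendsto_luxemburgNorm_translate_sub`), and the Orlicz norm `‖·‖_Ψ` is at most
`4 N_Ψ` (`complementaryOrliczNorm_le`).  Dominated convergence for the series of costs makes both
translations strongly continuous on `A_Φ(G)`.

Convolution is handled through representations: for a strongly continuous action `π` of `G` by
contractions on a Banach space, `f` and `u` have the Bochner integral `∫ f(y) π(y) u dy`
(`integratedForm`).  With left translation on `L¹(G)` it is the product of `L¹(G)`, whose
associativity is the linearity of the integral, and with left translation on `A_Φ(G)` it gives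
`f * u ∈ A_Φ(G)` and `‖f * u‖_{A_Φ} ≤ ‖f‖₁ ‖u‖_{A_Φ}`, since the embedding into `L¹(G)` commutes
with integrated forms (`FigaHerzOrliczSpace.toL1_integratedForm`).

Fubini's theorem is not applied to `(x, y) ↦ f(y) g(y⁻¹ x)`: when `G` is not second countable, this
function need not be measurable for the product σ-algebra.  That the product of `L¹(G)` is given by
the convolution integral almost everywhere (`isL1Convolution_integratedForm`) is clear for
continuous `g`, where the integral may be taken in `C(G)`, and follows for all `g` by writing `g` as
an absolutely convergent series of continuous functions in `L¹(G)`.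

Density (`FigaHerzOrliczSpace.denseRange_toL1`) comes from approximating a continuous `k` by the
averages of its translates over small neighbourhoods of the identity.
-/

/-! ### Young functions -/

/-- A finite Young function: a nonnegative even convex function on `ℝ` vanishing at `0`.  This is
all that the Luxemburg norm needs, and both an `N`-function and its complementary function have
these properties. -/
structure IsYoungFunction (Φ : ℝ → ℝ) : Prop where
  nonneg : ∀ x, 0 ≤ Φ x
  convex : ConvexOn ℝ Set.univ Φ
  even : ∀ x, Φ (-x) = Φ x
  map_zero : Φ 0 = 0

theorem IsNFunction.isYoungFunction {Φ : ℝ → ℝ} (hΦ : IsNFunction Φ) : IsYoungFunction Φ :=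
  ⟨hΦ.nonneg, hΦ.convex, hΦ.even, hΦ.map_zero⟩

namespace IsYoungFunction

variable {Φ : ℝ → ℝ} (hΦ : IsYoungFunction Φ)
include hΦ

theorem map_mul_le {c : ℝ} (hc : 0 ≤ c) (hc1 : c ≤ 1) (x : ℝ) : Φ (c * x) ≤ c * Φ x := by
  have := hΦ.convex.2 (Set.mem_univ x) (Set.mem_univ 0) hc (sub_nonneg.2 hc1) (by ring)
  simpa [hΦ.map_zero] using this

theorem mono {x y : ℝ} (hx : 0 ≤ x) (hxy : x ≤ y) : Φ x ≤ Φ y := by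
  rcases hx.eq_or_lt with rfl | hx'
  · rw [hΦ.map_zero]; exact hΦ.nonneg y
  have hy : 0 < y := hx'.trans_le hxy
  have h := hΦ.map_mul_le (c := x / y) (by positivity) ((div_le_one hy).2 hxy) y
  rw [div_mul_cancel₀ _ hy.ne'] at h
  exact h.trans (mul_le_of_le_one_left (hΦ.nonneg y) ((div_le_one hy).2 hxy))

theorem continuous : Continuous Φ :=
  continuousOn_univ.1 (hΦ.convex.continuousOn isOpen_univ)

theorem map_add_le {s t : ℝ} (hs : 0 ≤ s) (ht : 0 ≤ t) (hst : s + t = 1) (x y : ℝ) :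
    Φ (s * x + t * y) ≤ s * Φ x + t * Φ y := by
  simpa using hΦ.convex.2 (Set.mem_univ x) (Set.mem_univ y) hs ht hst

end IsYoungFunction

section Complementary

variable {Φ : ℝ → ℝ} (hΦ : IsNFunction Φ)
include hΦ

/-- Superlinearity of `Φ` makes the supremum defining the complementary function finite. -/
theorem IsNFunction.bddAbove_complementary (y : ℝ) :
    BddAbove ((fun x => x * |y| - Φ x) '' Set.Ici 0) := by
  obtain ⟨X, hX⟩ := (hΦ.tendsto_top.eventually_ge_atTop |y|).exists_forall_of_atTop
  refine ⟨max X 1 * |y|, ?_⟩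
  rintro _ ⟨x, hx : 0 ≤ x, rfl⟩
  have hy := abs_nonneg y
  have h0 := hΦ.nonneg x
  rcases le_total x (max X 1) with h | h
  · dsimp only
    nlinarith
  · have hx0 : 0 < x := lt_of_lt_of_le one_pos ((le_max_right _ _).trans h)
    have := hX x ((le_max_left _ _).trans h)
    rw [le_div_iff₀ hx0] at this
    have h1 : 0 ≤ max X 1 * |y| := by positivity
    dsimp only
    nlinarith

/-- Young's inequality. -/
theorem IsNFunction.mul_le_add {x y : ℝ} (hx : 0 ≤ x) (hy : 0 ≤ y) :
    x * y ≤ Φ x + complementary Φ y := by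
  have := le_csSup (hΦ.bddAbove_complementary y) ⟨x, hx, rfl⟩
  rw [abs_of_nonneg hy] at this
  unfold complementary
  rw [abs_of_nonneg hy]
  linarith

theorem IsNFunction.isYoungFunction_complementary : IsYoungFunction (complementary Φ) where
  nonneg y := by
    have := le_csSup (hΦ.bddAbove_complementary y) ⟨0, le_refl (0 : ℝ), rfl⟩
    simpa [hΦ.map_zero, complementary] using this
  convex := by
    refine ⟨convex_univ, fun y _ z _ a b ha hb hab => ?_⟩
    refine csSup_le ⟨_, 0, le_refl (0 : ℝ), rfl⟩ ?_
    rintro _ ⟨x, hx : 0 ≤ x, rfl⟩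
    have h1 := le_csSup (hΦ.bddAbove_complementary y) ⟨x, hx, rfl⟩
    have h2 := le_csSup (hΦ.bddAbove_complementary z) ⟨x, hx, rfl⟩
    have h3 : |a * y + b * z| ≤ a * |y| + b * |z| := by
      refine (abs_add_le _ _).trans ?_
      rw [abs_mul, abs_mul, abs_of_nonneg ha, abs_of_nonneg hb]
    simp only [smul_eq_mul]
    calc x * |a * y + b * z| - Φ x ≤ x * (a * |y| + b * |z|) - (a + b) * Φ x := by
          rw [hab]; nlinarith
      _ = a * (x * |y| - Φ x) + b * (x * |z| - Φ x) := by ring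
      _ ≤ _ := add_le_add (mul_le_mul_of_nonneg_left h1 ha) (mul_le_mul_of_nonneg_left h2 hb)
  even y := by simp [complementary]
  map_zero := by
    refine le_antisymm (csSup_le ⟨_, 0, le_refl (0 : ℝ), rfl⟩ ?_) ?_
    · rintro _ ⟨x, -, rfl⟩
      simpa using hΦ.nonneg x
    · have := le_csSup (hΦ.bddAbove_complementary 0) ⟨0, le_refl (0 : ℝ), rfl⟩
      simpa [hΦ.map_zero, complementary] using this

end Complementary

/-! ### The Luxemburg norm and the Morse-Transue space -/

section Luxemburg

variable {G : Type*} [MeasurableSpace G] {Φ : ℝ → ℝ} {μ : Measure G}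

theorem modular_mono_ae (hΦ : IsYoungFunction Φ) {f g : G → ℂ} (h : ∀ᵐ x ∂μ, ‖f x‖ ≤ ‖g x‖) :
    modular Φ μ f ≤ modular Φ μ g :=
  lintegral_mono_ae <| h.mono fun _ hx => ENNReal.ofReal_le_ofReal (hΦ.mono (norm_nonneg _) hx)

theorem modular_mono (hΦ : IsYoungFunction Φ) {f g : G → ℂ} (h : ∀ x, ‖f x‖ ≤ ‖g x‖) :
    modular Φ μ f ≤ modular Φ μ g :=
  modular_mono_ae hΦ (ae_of_all _ h)

theorem IsYoungFunction.aemeasurable_modular (hΦ : IsYoungFunction Φ) {f : G → ℂ}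
    (hf : AEStronglyMeasurable f μ) : AEMeasurable (fun x => ENNReal.ofReal (Φ ‖f x‖)) μ :=
  (hΦ.continuous.measurable.comp_aemeasurable hf.norm.aemeasurable).ennreal_ofReal

theorem modular_mul_le (hΦ : IsYoungFunction Φ) {c : ℝ} (hc : 0 ≤ c) (hc1 : c ≤ 1)
    (f : G → ℂ) : modular Φ μ (fun x => (c : ℂ) * f x) ≤ ENNReal.ofReal c * modular Φ μ f := by
  unfold modular
  rw [← lintegral_const_mul' _ _ ENNReal.ofReal_ne_top]
  refine lintegral_mono fun x => ?_
  rw [← ENNReal.ofReal_mul hc]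
  refine ENNReal.ofReal_le_ofReal ?_
  rw [norm_mul, Complex.norm_real, Real.norm_of_nonneg hc]
  exact hΦ.map_mul_le hc hc1 _

theorem modular_add_le (hΦ : IsYoungFunction Φ) {s t : ℝ} (hs : 0 ≤ s) (ht : 0 ≤ t)
    (hst : s + t = 1) {f : G → ℂ} (hf : AEStronglyMeasurable f μ) (g : G → ℂ) :
    modular Φ μ (fun x => (s : ℂ) * f x + (t : ℂ) * g x) ≤
      ENNReal.ofReal s * modular Φ μ f + ENNReal.ofReal t * modular Φ μ g := by
  unfold modular
  rw [← lintegral_const_mul' _ _ ENNReal.ofReal_ne_top,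
    ← lintegral_const_mul' _ _ ENNReal.ofReal_ne_top,
    ← lintegral_add_left' ((hΦ.aemeasurable_modular hf).const_mul _)]
  refine lintegral_mono fun x => ?_
  rw [← ENNReal.ofReal_mul hs, ← ENNReal.ofReal_mul ht,
    ← ENNReal.ofReal_add (mul_nonneg hs (hΦ.nonneg _)) (mul_nonneg ht (hΦ.nonneg _))]
  refine ENNReal.ofReal_le_ofReal ((hΦ.mono (norm_nonneg _) ?_).trans
    (hΦ.map_add_le hs ht hst ‖f x‖ ‖g x‖))
  refine (norm_add_le _ _).trans_eq ?_
  rw [norm_mul, norm_mul, Complex.norm_real, Complex.norm_real, Real.norm_of_nonneg hs,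
    Real.norm_of_nonneg ht]

theorem luxemburgNorm_le_of_modular_le {f : G → ℂ} {k : ℝ} (hk : 0 < k)
    (h : modular Φ μ (fun x => f x / (k : ℂ)) ≤ 1) : luxemburgNorm Φ μ f ≤ ENNReal.ofReal k :=
  iInf_le_of_le k <| iInf_le_of_le hk <| iInf_le _ h

theorem modular_le_of_luxemburgNorm_lt (hΦ : IsYoungFunction Φ) {f : G → ℂ} {k : ℝ}
    (h : luxemburgNorm Φ μ f < ENNReal.ofReal k) :
    modular Φ μ (fun x => f x / (k : ℂ)) ≤ 1 := by
  simp only [luxemburgNorm, iInf_lt_iff] at h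
  obtain ⟨l, hl, hle, hlk⟩ := h
  have hlk' : l < k := (ENNReal.ofReal_lt_ofReal_iff_of_nonneg hl.le).1 hlk
  refine (modular_mono hΦ fun x => ?_).trans hle
  rw [norm_div, norm_div, Complex.norm_real, Complex.norm_real, Real.norm_of_nonneg hl.le,
    Real.norm_of_nonneg (hl.trans hlk').le]
  gcongr

/-- To bound a Luxemburg norm from above, it suffices to bound it by every admissible `k`. -/
theorem luxemburgNorm_le_of_forall_lt {f : G → ℂ} {a : ℝ≥0∞}
    (h : ∀ k : ℝ, 0 < k → a < ENNReal.ofReal k →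
      modular Φ μ (fun x => f x / (k : ℂ)) ≤ 1) : luxemburgNorm Φ μ f ≤ a := by
  refine le_of_forall_gt fun b hb => ?_
  obtain ⟨c, hac, hcb⟩ := exists_between hb
  have hc : c ≠ ∞ := (hcb.trans_le le_top).ne
  have hc0 : 0 < c.toReal := ENNReal.toReal_pos (by rintro rfl; simp at hac) hc
  refine lt_of_le_of_lt ?_ hcb
  rw [← ENNReal.ofReal_toReal hc]
  refine luxemburgNorm_le_of_modular_le hc0 (h _ hc0 ?_)
  rwa [ENNReal.ofReal_toReal hc]

theorem luxemburgNorm_zero (hΦ : IsYoungFunction Φ) : luxemburgNorm Φ μ (fun _ => 0) = 0 := by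
  refine le_antisymm (luxemburgNorm_le_of_forall_lt fun k _ _ => ?_) zero_le
  simp [modular, hΦ.map_zero]

theorem luxemburgNorm_add_le (hΦ : IsYoungFunction Φ) {f : G → ℂ}
    (hf : AEStronglyMeasurable f μ) (g : G → ℂ) :
    luxemburgNorm Φ μ (fun x => f x + g x) ≤ luxemburgNorm Φ μ f + luxemburgNorm Φ μ g := by
  refine ENNReal.le_of_forall_pos_le_add fun ε hε hlt => ?_
  obtain ⟨hfin, hgin⟩ := ENNReal.add_lt_top.1 hlt
  set a := (luxemburgNorm Φ μ f).toReal
  set b := (luxemburgNorm Φ μ g).toReal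
  have hε' : (0 : ℝ) < ε := hε
  have ha : luxemburgNorm Φ μ f = ENNReal.ofReal a := (ENNReal.ofReal_toReal hfin.ne).symm
  have hb : luxemburgNorm Φ μ g = ENNReal.ofReal b := (ENNReal.ofReal_toReal hgin.ne).symm
  have ha0 : 0 ≤ a := ENNReal.toReal_nonneg
  have hb0 : 0 ≤ b := ENNReal.toReal_nonneg
  have hk : 0 < a + ε / 2 := by positivity
  have hl : 0 < b + ε / 2 := by positivity
  have h1 : modular Φ μ (fun x => f x / ((a + ε / 2 : ℝ) : ℂ)) ≤ 1 :=
    modular_le_of_luxemburgNorm_lt hΦ (by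
      rw [ha]; exact (ENNReal.ofReal_lt_ofReal_iff hk).2 (by linarith))
  have h2 : modular Φ μ (fun x => g x / ((b + ε / 2 : ℝ) : ℂ)) ≤ 1 :=
    modular_le_of_luxemburgNorm_lt hΦ (by
      rw [hb]; exact (ENNReal.ofReal_lt_ofReal_iff hl).2 (by linarith))
  have hsum : luxemburgNorm Φ μ f + luxemburgNorm Φ μ g + (ε : ℝ≥0∞) =
      ENNReal.ofReal ((a + ε / 2) + (b + ε / 2)) := by
    rw [ha, hb, ← ENNReal.ofReal_add ha0 hb0, ← ENNReal.ofReal_coe_nnreal (p := ε),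
      ← ENNReal.ofReal_add (by positivity) hε'.le]
    congr 1; ring
  rw [hsum]
  generalize a + (ε : ℝ) / 2 = k at *
  generalize b + (ε : ℝ) / 2 = l at *
  refine luxemburgNorm_le_of_modular_le (by positivity) ?_
  have h3 := modular_add_le (μ := μ) hΦ (s := k / (k + l)) (t := l / (k + l)) (by positivity)
    (by positivity) (by field_simp) (f := fun x => f x / (k : ℂ))
    (by simpa only [div_eq_mul_inv] using hf.mul_const _)
    (fun x => g x / (l : ℂ))
  have hk' : (k : ℂ) ≠ 0 := by exact_mod_cast hk.ne'
  have hl' : (l : ℂ) ≠ 0 := by exact_mod_cast hl.ne'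
  have hkl' : (k + l : ℂ) ≠ 0 := by exact_mod_cast (add_pos hk hl).ne'
  calc modular Φ μ (fun x => (f x + g x) / ((k + l : ℝ) : ℂ))
      = _ := by
        congr 1
        ext x
        push_cast
        field_simp
    _ ≤ _ := h3
    _ ≤ ENNReal.ofReal (k / (k + l)) * 1 + ENNReal.ofReal (l / (k + l)) * 1 := by gcongr
    _ = 1 := by
        rw [mul_one, mul_one, ← ENNReal.ofReal_add (by positivity) (by positivity),
          ← add_div, div_self (add_pos hk hl).ne', ENNReal.ofReal_one]

theorem luxemburgNorm_const_mul_le (hΦ : IsYoungFunction Φ) (c : ℂ) (f : G → ℂ) :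
    luxemburgNorm Φ μ (fun x => c * f x) ≤ ‖c‖ₑ * luxemburgNorm Φ μ f := by
  rcases eq_or_ne c 0 with rfl | hc
  · simp [luxemburgNorm_zero hΦ]
  have hc' : 0 < ‖c‖ := norm_pos_iff.2 hc
  refine luxemburgNorm_le_of_forall_lt fun k hk hlt => ?_
  have h : luxemburgNorm Φ μ f < ENNReal.ofReal (k / ‖c‖) := by
    rw [ENNReal.ofReal_div_of_pos hc', ENNReal.lt_div_iff_mul_lt (by simp [hc]) (by simp),
      ofReal_norm, mul_comm]
    exact hlt
  refine (modular_mono hΦ fun x => le_of_eq ?_).trans (modular_le_of_luxemburgNorm_lt hΦ h)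
  rw [norm_div, norm_div, norm_mul, Complex.norm_real, Complex.norm_real,
    Real.norm_of_nonneg hk.le, Real.norm_of_nonneg (by positivity)]
  field_simp

theorem luxemburgNorm_neg (f : G → ℂ) :
    luxemburgNorm Φ μ (fun x => -f x) = luxemburgNorm Φ μ f := by
  simp [luxemburgNorm, modular]

theorem MemMorseTransue.luxemburgNorm_lt_top (hΦ : IsYoungFunction Φ) {f : G → ℂ}
    (hf : MemMorseTransue Φ μ f) : luxemburgNorm Φ μ f < ∞ := by
  have h1 : modular Φ μ f < ∞ := by simpa using hf.2 1 one_pos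
  set R := (modular Φ μ f).toReal
  have hR : modular Φ μ f = ENNReal.ofReal R := (ENNReal.ofReal_toReal h1.ne).symm
  have hk : 0 < max R 1 := by positivity
  refine (luxemburgNorm_le_of_modular_le hk ?_).trans_lt ENNReal.ofReal_lt_top
  have h2 := modular_mul_le (μ := μ) hΦ (c := (max R 1)⁻¹) (by positivity)
    (inv_le_one_of_one_le₀ (le_max_right _ _)) f
  rw [hR, ← ENNReal.ofReal_mul (by positivity)] at h2
  simp only [div_eq_mul_inv]
  simp only [Complex.ofReal_inv, mul_comm _ (f _)] at h2
  refine h2.trans ?_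
  rw [ENNReal.ofReal_le_one, inv_mul_le_one₀ hk]
  exact le_max_left _ _

theorem MemMorseTransue.const_mul (hΦ : IsYoungFunction Φ) (c : ℂ) {f : G → ℂ}
    (hf : MemMorseTransue Φ μ f) : MemMorseTransue Φ μ (fun x => c * f x) := by
  refine ⟨hf.1.const_mul c, fun a ha => ?_⟩
  refine (modular_mono hΦ fun x => ?_).trans_lt (hf.2 (a * (‖c‖ + 1)) (by positivity))
  rw [norm_mul, norm_mul, norm_mul, Complex.norm_real, Complex.norm_real,
    Real.norm_of_nonneg ha.le, Real.norm_of_nonneg (by positivity), ← mul_assoc]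
  gcongr
  linarith

theorem MemMorseTransue.neg {f : G → ℂ} (hf : MemMorseTransue Φ μ f) :
    MemMorseTransue Φ μ (fun x => -f x) :=
  ⟨hf.1.neg, fun a ha => by simpa [modular] using hf.2 a ha⟩

theorem MemMorseTransue.add (hΦ : IsYoungFunction Φ) {f g : G → ℂ}
    (hf : MemMorseTransue Φ μ f) (hg : MemMorseTransue Φ μ g) :
    MemMorseTransue Φ μ (fun x => f x + g x) := by
  refine ⟨hf.1.add hg.1, fun a ha => ?_⟩
  have h := modular_add_le (μ := μ) hΦ (s := 1 / 2) (t := 1 / 2) (by norm_num) (by norm_num)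
    (by norm_num) (hf.1.const_mul ((2 * a : ℝ) : ℂ)) (fun x => ((2 * a : ℝ) : ℂ) * g x)
  have h2a : 0 < 2 * a := by positivity
  refine lt_of_eq_of_lt ?_ (h.trans_lt (ENNReal.add_lt_top.2
    ⟨ENNReal.mul_lt_top ENNReal.ofReal_lt_top (hf.2 _ h2a),
     ENNReal.mul_lt_top ENNReal.ofReal_lt_top (hg.2 _ h2a)⟩))
  congr 1
  ext x
  push_cast
  ring

theorem MemMorseTransue.sub (hΦ : IsYoungFunction Φ) {f g : G → ℂ}
    (hf : MemMorseTransue Φ μ f) (hg : MemMorseTransue Φ μ g) :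
    MemMorseTransue Φ μ (fun x => f x - g x) := by
  simpa only [sub_eq_add_neg] using hf.add hΦ hg.neg

theorem memMorseTransue_of_bounded [IsFiniteMeasure μ] (hΦ : IsYoungFunction Φ) {f : G → ℂ}
    (hf : AEStronglyMeasurable f μ) {B : ℝ} (hB : ∀ x, ‖f x‖ ≤ B) : MemMorseTransue Φ μ f := by
  refine ⟨hf, fun a ha => ?_⟩
  calc modular Φ μ (fun x => (a : ℂ) * f x) ≤ ∫⁻ _, ENNReal.ofReal (Φ (a * B)) ∂μ := by
        refine lintegral_mono fun x => ENNReal.ofReal_le_ofReal (hΦ.mono (norm_nonneg _) ?_)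
        rw [norm_mul, Complex.norm_real, Real.norm_of_nonneg ha.le]
        exact mul_le_mul_of_nonneg_left (hB x) ha.le
    _ < ∞ := by
        rw [lintegral_const]
        exact ENNReal.mul_lt_top ENNReal.ofReal_lt_top (measure_lt_top _ _)

/-- Truncations approximate the elements of `M^Φ` in the Luxemburg norm. -/
theorem MemMorseTransue.exists_bounded_luxemburgNorm_sub_le (hΦ : IsYoungFunction Φ) {f : G → ℂ}
    (hf : MemMorseTransue Φ μ f) {ε : ℝ} (hε : 0 < ε) :
    ∃ g : G → ℂ, AEStronglyMeasurable g μ ∧ (∃ B : ℝ, ∀ x, ‖g x‖ ≤ B) ∧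
      luxemburgNorm Φ μ (fun x => f x - g x) ≤ ENNReal.ofReal ε := by
  -- It is enough to truncate a measurable modification of `f`.
  set f' := hf.1.mk f
  have hf' : StronglyMeasurable f' := hf.1.stronglyMeasurable_mk
  have hff' : f =ᵐ[μ] f' := hf.1.ae_eq_mk
  let s : ℕ → Set G := fun n => {x | ‖f' x‖ ≤ n}
  have hs : ∀ n, MeasurableSet (s n) := fun n => hf'.norm.measurable measurableSet_Iic
  have hlim : Tendsto (fun n => modular Φ μ (fun x => (f x - (s n).indicator f' x) / (ε : ℂ)))
      atTop (𝓝 0) := by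
    have h0 : ∫⁻ _ : G, 0 ∂μ = (0 : ℝ≥0∞) := lintegral_zero
    rw [← h0]
    refine tendsto_lintegral_of_dominated_convergence'
      (fun x => ENNReal.ofReal (Φ ‖((ε⁻¹ : ℝ) : ℂ) * f x‖)) (fun n => ?_) (fun n => ?_)
      (hf.2 _ (inv_pos.2 hε)).ne ?_
    · refine hΦ.aemeasurable_modular ?_
      simp only [div_eq_mul_inv]
      exact (hf.1.sub (hf'.indicator (hs n)).aestronglyMeasurable).mul_const _
    · filter_upwards [hff'] with x hx
      refine ENNReal.ofReal_le_ofReal (hΦ.mono (norm_nonneg _) ?_)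
      rw [norm_div, norm_mul, Complex.norm_real, Complex.norm_real, norm_inv, div_eq_inv_mul]
      gcongr
      by_cases h : x ∈ s n <;> simp [h, hx]
    · filter_upwards [hff'] with x hx
      refine tendsto_const_nhds.congr' ?_
      obtain ⟨N, hN⟩ := exists_nat_ge ‖f' x‖
      filter_upwards [eventually_ge_atTop N] with n hn
      have : x ∈ s n := hN.trans (by exact_mod_cast hn)
      simp [this, hx, hΦ.map_zero]
  obtain ⟨n, hn⟩ := (hlim.eventually (ge_mem_nhds one_pos)).exists
  refine ⟨(s n).indicator f', (hf'.indicator (hs n)).aestronglyMeasurable, ⟨n, fun x => ?_⟩,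
    luxemburgNorm_le_of_modular_le hε hn⟩
  by_cases h : x ∈ s n
  · rw [Set.indicator_of_mem h]; exact h
  · simp [h]

/-- On functions bounded by `B`, the modular is controlled by the `L¹` norm. -/
theorem modular_le_of_bounded (hΦ : IsYoungFunction Φ) {f : G → ℂ} {B : ℝ} (hB : 0 < B)
    (hf : ∀ x, ‖f x‖ ≤ B) : modular Φ μ f ≤ ENNReal.ofReal (Φ B / B) * ∫⁻ x, ‖f x‖ₑ ∂μ := by
  unfold modular
  rw [← lintegral_const_mul' _ _ ENNReal.ofReal_ne_top]
  refine lintegral_mono fun x => ?_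
  rw [← ofReal_norm, ← ENNReal.ofReal_mul (div_nonneg (hΦ.nonneg _) hB.le)]
  refine ENNReal.ofReal_le_ofReal ?_
  have h := hΦ.map_mul_le (c := ‖f x‖ / B) (by positivity) ((div_le_one hB).2 (hf x)) B
  rw [div_mul_cancel₀ _ hB.ne'] at h
  exact h.trans_eq (by ring)

end Luxemburg

/-! ### The Orlicz norm and Hölder's inequality -/

section OrliczNorm

variable {G : Type*} [MeasurableSpace G] {Φ : ℝ → ℝ} {μ : Measure G}

theorem lintegral_mul_le_complementaryOrliczNorm {g h : G → ℂ} (hh : AEStronglyMeasurable h μ)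
    (hN : luxemburgNorm Φ μ h ≤ 1) :
    ∫⁻ x, ‖g x * h x‖ₑ ∂μ ≤ complementaryOrliczNorm Φ μ g :=
  le_iSup_of_le h <| le_iSup_of_le hh <|
    le_iSup (fun _ : luxemburgNorm Φ μ h ≤ 1 => ∫⁻ x, ‖g x * h x‖ₑ ∂μ) hN

theorem complementaryOrliczNorm_zero : complementaryOrliczNorm Φ μ (fun _ => 0) = 0 := by
  simp [complementaryOrliczNorm]

theorem complementaryOrliczNorm_neg (g : G → ℂ) :
    complementaryOrliczNorm Φ μ (fun x => -g x) = complementaryOrliczNorm Φ μ g := by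
  simp [complementaryOrliczNorm]

theorem complementaryOrliczNorm_add_le {f : G → ℂ} (hf : AEStronglyMeasurable f μ) (g : G → ℂ) :
    complementaryOrliczNorm Φ μ (fun x => f x + g x) ≤
      complementaryOrliczNorm Φ μ f + complementaryOrliczNorm Φ μ g := by
  refine iSup_le fun h => iSup_le fun hh => iSup_le fun hN => ?_
  calc ∫⁻ x, ‖(f x + g x) * h x‖ₑ ∂μ ≤ ∫⁻ x, (‖f x * h x‖ₑ + ‖g x * h x‖ₑ) ∂μ :=
        lintegral_mono fun x => by
          simp only [add_mul]
          exact enorm_add_le _ _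
    _ = ∫⁻ x, ‖f x * h x‖ₑ ∂μ + ∫⁻ x, ‖g x * h x‖ₑ ∂μ := lintegral_add_left' (hf.mul hh).enorm _
    _ ≤ _ := add_le_add (lintegral_mul_le_complementaryOrliczNorm hh hN)
        (lintegral_mul_le_complementaryOrliczNorm hh hN)

/-- The Orlicz norm is dominated by the Luxemburg norm of the complementary function: this is
Young's inequality, integrated. -/
theorem complementaryOrliczNorm_le (hΦ : IsNFunction Φ) (g : G → ℂ) :
    complementaryOrliczNorm Φ μ g ≤ 4 * luxemburgNorm (complementary Φ) μ g := by
  have hΨ := hΦ.isYoungFunction_complementary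
  refine iSup_le fun h => iSup_le fun hh => iSup_le fun hN => ?_
  have hN2 : modular Φ μ (fun x => h x / ((2 : ℝ) : ℂ)) ≤ 1 :=
    modular_le_of_luxemburgNorm_lt hΦ.isYoungFunction (hN.trans_lt (by norm_num))
  have key : ∀ k : ℝ, 0 < k → luxemburgNorm (complementary Φ) μ g < ENNReal.ofReal k →
      ∫⁻ x, ‖g x * h x‖ₑ ∂μ ≤ 4 * ENNReal.ofReal k := by
    intro k hk hlt
    have hM := modular_le_of_luxemburgNorm_lt hΨ hlt
    calc ∫⁻ x, ‖g x * h x‖ₑ ∂μ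
        ≤ ∫⁻ x, ENNReal.ofReal (2 * k) * (ENNReal.ofReal (Φ ‖h x / ((2 : ℝ) : ℂ)‖) +
            ENNReal.ofReal (complementary Φ ‖g x / (k : ℂ)‖)) ∂μ := by
          refine lintegral_mono fun x => ?_
          rw [← ENNReal.ofReal_add (hΦ.nonneg _) (hΨ.nonneg _),
            ← ENNReal.ofReal_mul (by positivity), ← ofReal_norm]
          refine ENNReal.ofReal_le_ofReal ?_
          have := hΦ.mul_le_add (norm_nonneg (h x / ((2 : ℝ) : ℂ)))
            (norm_nonneg (g x / (k : ℂ)))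
          calc ‖g x * h x‖ = 2 * k * (‖h x / ((2 : ℝ) : ℂ)‖ * ‖g x / (k : ℂ)‖) := by
                rw [norm_mul, norm_div, norm_div, Complex.norm_real, Complex.norm_real,
                  Real.norm_of_nonneg hk.le, Real.norm_of_nonneg zero_le_two]
                field_simp
            _ ≤ _ := by gcongr
      _ = ENNReal.ofReal (2 * k) * (modular Φ μ (fun x => h x / ((2 : ℝ) : ℂ)) +
            modular (complementary Φ) μ (fun x => g x / (k : ℂ))) := by
          rw [lintegral_const_mul' _ _ ENNReal.ofReal_ne_top, lintegral_add_left']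
          · rfl
          · refine hΦ.isYoungFunction.aemeasurable_modular ?_
            simpa only [div_eq_mul_inv] using hh.mul_const _
      _ ≤ ENNReal.ofReal (2 * k) * (1 + 1) := by gcongr
      _ = 4 * ENNReal.ofReal k := by
          rw [ENNReal.ofReal_mul zero_le_two, ENNReal.ofReal_ofNat, mul_comm (2 : ℝ≥0∞) _,
            mul_assoc, mul_comm]
          norm_num
  rw [mul_comm, ← ENNReal.div_le_iff_le_mul (by simp) (by simp)]
  refine le_of_forall_gt fun b hb => ?_
  obtain ⟨c, hac, hcb⟩ := exists_between hb
  have hc : c ≠ ∞ := (hcb.trans_le le_top).ne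
  have hc0 : 0 < c.toReal := ENNReal.toReal_pos (by rintro rfl; simp at hac) hc
  refine lt_of_le_of_lt ?_ hcb
  rw [ENNReal.div_le_iff_le_mul (by simp) (by simp), mul_comm]
  have := key _ hc0
  rw [ENNReal.ofReal_toReal hc] at this
  exact this hac

theorem MemMorseTransue.complementaryOrliczNorm_lt_top (hΦ : IsNFunction Φ) {g : G → ℂ}
    (hg : MemMorseTransue (complementary Φ) μ g) : complementaryOrliczNorm Φ μ g < ∞ :=
  (complementaryOrliczNorm_le hΦ g).trans_lt
    (ENNReal.mul_lt_top (by simp) (hg.luxemburgNorm_lt_top hΦ.isYoungFunction_complementary))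

/-- Hölder's inequality. -/
theorem lintegral_mul_le_luxemburgNorm_mul (hΦ : IsYoungFunction Φ) {f g : G → ℂ}
    (hf : AEStronglyMeasurable f μ) (hfN : luxemburgNorm Φ μ f ≠ ∞)
    (hgN : complementaryOrliczNorm Φ μ g ≠ ∞) :
    ∫⁻ x, ‖f x * g x‖ₑ ∂μ ≤ luxemburgNorm Φ μ f * complementaryOrliczNorm Φ μ g := by
  -- `N_Φ(f)` may vanish, so `f` is normalized by `N_Φ(f) + ε` instead.
  have key : ∀ ε : NNReal, 0 < ε → ∫⁻ x, ‖f x * g x‖ₑ ∂μ ≤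
      (luxemburgNorm Φ μ f + ε) * complementaryOrliczNorm Φ μ g := by
    intro ε hε
    have hε' : (0 : ℝ) < ε := hε
    set k : ℝ := (luxemburgNorm Φ μ f).toReal + ε
    have hk : 0 < k := add_pos_of_nonneg_of_pos ENNReal.toReal_nonneg hε'
    have hk' : luxemburgNorm Φ μ f + ε = ENNReal.ofReal k := by
      rw [ENNReal.ofReal_add ENNReal.toReal_nonneg hε'.le, ENNReal.ofReal_toReal hfN,
        ENNReal.ofReal_coe_nnreal]
    have hkC : (k : ℂ) ≠ 0 := by exact_mod_cast hk.ne'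
    have hke : ‖((k⁻¹ : ℝ) : ℂ)‖ₑ * ENNReal.ofReal k = 1 := by
      rw [← ofReal_norm, Complex.norm_real, Real.norm_of_nonneg (by positivity),
        ← ENNReal.ofReal_mul (by positivity), inv_mul_cancel₀ hk.ne', ENNReal.ofReal_one]
    have h1 : luxemburgNorm Φ μ (fun x => ((k⁻¹ : ℝ) : ℂ) * f x) ≤ 1 := by
      refine (luxemburgNorm_const_mul_le hΦ _ _).trans ?_
      rw [← hke, ← hk']
      gcongr
      exact le_self_add
    have h2 := lintegral_mul_le_complementaryOrliczNorm (g := g) (hf.const_mul _) h1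
    rw [hk']
    calc ∫⁻ x, ‖f x * g x‖ₑ ∂μ
        = ∫⁻ x, ENNReal.ofReal k * ‖g x * (((k⁻¹ : ℝ) : ℂ) * f x)‖ₑ ∂μ := by
          refine lintegral_congr fun x => ?_
          rw [mul_left_comm, enorm_mul (((k⁻¹ : ℝ) : ℂ)), ← mul_assoc, mul_comm (ENNReal.ofReal k),
            hke, one_mul, mul_comm]
      _ = ENNReal.ofReal k * ∫⁻ x, ‖g x * (((k⁻¹ : ℝ) : ℂ) * f x)‖ₑ ∂μ :=
          lintegral_const_mul' _ _ ENNReal.ofReal_ne_top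
      _ ≤ _ := by gcongr
  refine ENNReal.le_of_forall_pos_le_add fun δ hδ _ => ?_
  set C := complementaryOrliczNorm Φ μ g
  have hC : C = ((C.toNNReal : NNReal) : ℝ≥0∞) := (ENNReal.coe_toNNReal hgN).symm
  refine (key (δ / (C.toNNReal + 1)) (by positivity)).trans ?_
  rw [add_mul]
  gcongr
  rw [hC]
  norm_cast
  rw [div_mul_eq_mul_div]
  refine div_le_of_le_mul₀ (by positivity) (by positivity) ?_
  gcongr
  simp

end OrliczNorm

/-! ### Invariance and translation of functions -/

section Invariance

variable {G : Type*} [Group G] [TopologicalSpace G] [IsTopologicalGroup G]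
    [CompactSpace G] [MeasurableSpace G] [BorelSpace G]
    {μ : Measure G} [μ.IsHaarMeasure]

theorem isMulRightInvariant_of_isProbabilityMeasure [IsProbabilityMeasure μ] :
    μ.IsMulRightInvariant := by
  refine ⟨fun g => ?_⟩
  have := Measure.isHaarMeasure_map_mul_right μ g
  have : IsProbabilityMeasure (μ.map (· * g)) :=
    Measure.isProbabilityMeasure_map (measurable_mul_const g).aemeasurable
  exact Measure.isHaarMeasure_eq_of_isProbabilityMeasure _ _

theorem isInvInvariant_of_isProbabilityMeasure [IsProbabilityMeasure μ] :
    μ.IsInvInvariant := by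
  have := isMulRightInvariant_of_isProbabilityMeasure (μ := μ)
  have h1 : IsProbabilityMeasure μ.inv :=
    Measure.isProbabilityMeasure_map measurable_inv.aemeasurable
  have h := Measure.isMulInvariant_eq_smul_of_compactSpace μ.inv μ
  refine ⟨?_⟩
  have hu := congrArg (fun ν : Measure G => ν Set.univ) h
  simp only [measure_univ, Measure.smul_apply] at hu
  rw [ENNReal.smul_def, smul_eq_mul, mul_one] at hu
  rw [h]
  have : Measure.haarScalarFactor μ.inv μ = 1 := by exact_mod_cast hu.symm
  rw [this, one_smul]

end Invariance

section TranslationNorm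

variable {G : Type*} [Group G] [MeasurableSpace G] [MeasurableMul G] {Φ : ℝ → ℝ}
    {μ : Measure G} [μ.IsMulLeftInvariant]

theorem aestronglyMeasurable_comp_mul_left {f : G → ℂ} (hf : AEStronglyMeasurable f μ) (t : G) :
    AEStronglyMeasurable (fun x => f (t * x)) μ :=
  hf.comp_measurePreserving (measurePreserving_mul_left μ t)

theorem modular_comp_mul_left (f : G → ℂ) (t : G) :
    modular Φ μ (fun x => f (t * x)) = modular Φ μ f :=
  lintegral_mul_left_eq_self (fun x => ENNReal.ofReal (Φ ‖f x‖)) t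

theorem luxemburgNorm_comp_mul_left (f : G → ℂ) (t : G) :
    luxemburgNorm Φ μ (fun x => f (t * x)) = luxemburgNorm Φ μ f := by
  have h (k : ℝ) := modular_comp_mul_left (Φ := Φ) (μ := μ) (fun x => f x / (k : ℂ)) t
  simp only [luxemburgNorm, h]

theorem MemMorseTransue.comp_mul_left {f : G → ℂ} (hf : MemMorseTransue Φ μ f) (t : G) :
    MemMorseTransue Φ μ (fun x => f (t * x)) :=
  ⟨aestronglyMeasurable_comp_mul_left hf.1 t, fun a ha => by
    rw [modular_comp_mul_left (fun x => (a : ℂ) * f x) t]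
    exact hf.2 a ha⟩

theorem complementaryOrliczNorm_comp_mul_left_le (g : G → ℂ) (t : G) :
    complementaryOrliczNorm Φ μ (fun x => g (t * x)) ≤ complementaryOrliczNorm Φ μ g := by
  refine iSup_le fun h => iSup_le fun hh => iSup_le fun hN => ?_
  have := lintegral_mul_left_eq_self (μ := μ) (fun x => ‖g x * h (t⁻¹ * x)‖ₑ) t
  simp only [inv_mul_cancel_left] at this
  rw [this]
  exact lintegral_mul_le_complementaryOrliczNorm (aestronglyMeasurable_comp_mul_left hh _)
    ((luxemburgNorm_comp_mul_left h _).trans_le hN)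

theorem complementaryOrliczNorm_comp_mul_left (g : G → ℂ) (t : G) :
    complementaryOrliczNorm Φ μ (fun x => g (t * x)) = complementaryOrliczNorm Φ μ g := by
  refine le_antisymm (complementaryOrliczNorm_comp_mul_left_le g t) ?_
  simpa using complementaryOrliczNorm_comp_mul_left_le (Φ := Φ) (μ := μ) (fun x => g (t * x)) t⁻¹

end TranslationNorm

/-! ### Integrated forms of representations -/

section IntegratedForm

variable {G : Type*} [Group G] [TopologicalSpace G] {E F : Type*} [NormedAddCommGroup E]
    [NormedSpace ℂ E] [NormedAddCommGroup F] [NormedSpace ℂ F]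

/-- A strongly continuous action of `G` on a normed space by linear contractions. -/
structure IsContractiveRep (π : G → E →L[ℂ] E) : Prop where
  map_mul : ∀ s t u, π (s * t) u = π s (π t u)
  norm_le : ∀ t u, ‖π t u‖ ≤ ‖u‖
  continuous : ∀ u, Continuous fun t => π t u

variable [MeasurableSpace G]

/-- The integrated form `∫ f(y) π(y) u dμ(y)` of a representation `π`, as a Bochner integral.
For the left translation of functions it is the convolution `f * u`. -/
noncomputable def integratedForm (μ : Measure G) (π : G → E →L[ℂ] E) (f : Lp ℂ 1 μ) (u : E) : E :=
  ∫ y, f y • π y u ∂μ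

variable [CompactSpace G] [BorelSpace G] {μ : Measure G} {π : G → E →L[ℂ] E}
    {σ : G → F →L[ℂ] F} (hπ : IsContractiveRep π) (hσ : IsContractiveRep σ)

include hπ

theorem IsContractiveRep.integrable (f : Lp ℂ 1 μ) (u : E) :
    Integrable (fun y => f y • π y u) μ := by
  refine (L1.integrable_coeFn f).smul_of_top_left ?_
  exact memLp_top_of_bound (hπ.continuous u).aestronglyMeasurable_of_compactSpace ‖u‖
    (ae_of_all _ fun y => hπ.norm_le y u)

theorem IsContractiveRep.norm_integratedForm_le (f : Lp ℂ 1 μ) (u : E) :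
    ‖integratedForm μ π f u‖ ≤ ‖f‖ * ‖u‖ := by
  calc ‖integratedForm μ π f u‖ ≤ ∫ y, ‖f y • π y u‖ ∂μ := norm_integral_le_integral_norm _
    _ ≤ ∫ y, ‖f y‖ * ‖u‖ ∂μ := by
        refine integral_mono (hπ.integrable f u).norm ((L1.integrable_coeFn f).norm.mul_const _)
          fun y => ?_
        rw [norm_smul]
        exact mul_le_mul_of_nonneg_left (hπ.norm_le y u) (norm_nonneg _)
    _ = ‖f‖ * ‖u‖ := by rw [integral_mul_const, L1.norm_eq_integral_norm]

theorem IsContractiveRep.integratedForm_add_left (f g : Lp ℂ 1 μ) (u : E) :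
    integratedForm μ π (f + g) u = integratedForm μ π f u + integratedForm μ π g u := by
  rw [integratedForm, integratedForm, integratedForm,
    ← integral_add (hπ.integrable f u) (hπ.integrable g u)]
  refine integral_congr_ae ?_
  filter_upwards [Lp.coeFn_add f g] with y hy
  rw [hy, Pi.add_apply, add_smul]

theorem IsContractiveRep.integratedForm_add_right (f : Lp ℂ 1 μ) (u v : E) :
    integratedForm μ π f (u + v) = integratedForm μ π f u + integratedForm μ π f v := by
  rw [integratedForm, integratedForm, integratedForm,
    ← integral_add (hπ.integrable f u) (hπ.integrable f v)]
  simp only [map_add, smul_add]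

omit [Group G] [TopologicalSpace G] [CompactSpace G] [BorelSpace G] hπ in
theorem integratedForm_smul_left (c : ℂ) (f : Lp ℂ 1 μ) (u : E) :
    integratedForm μ π (c • f) u = c • integratedForm μ π f u := by
  rw [integratedForm, integratedForm, ← integral_smul]
  refine integral_congr_ae ?_
  filter_upwards [Lp.coeFn_smul c f] with y hy
  rw [hy, Pi.smul_apply, smul_assoc]

omit [Group G] [TopologicalSpace G] [CompactSpace G] [BorelSpace G] hπ in
theorem integratedForm_smul_right (c : ℂ) (f : Lp ℂ 1 μ) (u : E) :
    integratedForm μ π f (c • u) = c • integratedForm μ π f u := by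
  rw [integratedForm, integratedForm, ← integral_smul]
  simp only [map_smul, smul_comm c]

/-- The integrated form, as a continuous linear map in its first argument. -/
noncomputable def IsContractiveRep.integratedFormCLM (μ : Measure G) (u : E) :
    Lp ℂ 1 μ →L[ℂ] E :=
  LinearMap.mkContinuous
    { toFun := fun f => integratedForm μ π f u
      map_add' := fun f g => hπ.integratedForm_add_left f g u
      map_smul' := fun c f => integratedForm_smul_left c f u } ‖u‖ fun f => by
    rw [mul_comm]
    exact hπ.norm_integratedForm_le f u

/-- The integrated form, as a continuous linear map in its second argument. -/
noncomputable def IsContractiveRep.integratedFormCLMRight (f : Lp ℂ 1 μ) : E →L[ℂ] E :=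
  LinearMap.mkContinuous
    { toFun := fun u => integratedForm μ π f u
      map_add' := fun u v => hπ.integratedForm_add_right f u v
      map_smul' := fun c u => integratedForm_smul_right c f u } ‖f‖
    (hπ.norm_integratedForm_le f)

/-- Integrated forms commute with bounded maps that intertwine the representations. -/
theorem IsContractiveRep.map_integratedForm [CompleteSpace E] [CompleteSpace F] (T : E →L[ℂ] F)
    (hT : ∀ t u, T (π t u) = σ t (T u)) (f : Lp ℂ 1 μ) (u : E) :
    T (integratedForm μ π f u) = integratedForm μ σ f (T u) := by
  rw [integratedForm, integratedForm, ← T.integral_comp_comm (hπ.integrable f u)]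
  simp only [map_smul, hT]

end IntegratedForm

/-! ### Left translation on `C(G)` and on `L¹(G)` -/

section Translation

variable {G : Type*} [Group G] [TopologicalSpace G] [IsTopologicalGroup G] [CompactSpace G]

/-- Left translation `(L_t k)(x) = k(t⁻¹ x)` on `C(G)`. -/
noncomputable def contLeftTranslation (t : G) : C(G, ℂ) →L[ℂ] C(G, ℂ) :=
  LinearMap.mkContinuous
    { toFun := fun k => k.comp ⟨fun x => t⁻¹ * x, continuous_const_mul _⟩
      map_add' := fun _ _ => rfl
      map_smul' := fun _ _ => rfl } 1 fun k => by
    rw [one_mul, ContinuousMap.norm_le _ (norm_nonneg k)]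
    exact fun x => k.norm_coe_le_norm _

@[simp]
theorem contLeftTranslation_apply (t : G) (k : C(G, ℂ)) (x : G) :
    contLeftTranslation t k x = k (t⁻¹ * x) := rfl

theorem isContractiveRep_contLeftTranslation :
    IsContractiveRep (contLeftTranslation (G := G)) where
  map_mul s t k := by ext x; simp [mul_assoc]
  norm_le t k := by
    rw [ContinuousMap.norm_le _ (norm_nonneg k)]
    exact fun x => k.norm_coe_le_norm _
  continuous k := by
    let K : C(G × G, ℂ) := ⟨fun p => k (p.1⁻¹ * p.2), by fun_prop⟩
    exact K.curry.continuous

variable [MeasurableSpace G] [BorelSpace G] {μ : Measure G} [μ.IsHaarMeasure]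

variable (μ) in
/-- Left translation `(L_t v)(x) = v(t⁻¹ x)` on `L¹(G)`. -/
noncomputable def lpLeftTranslation (t : G) : Lp ℂ 1 μ →L[ℂ] Lp ℂ 1 μ :=
  (Lp.compMeasurePreservingₗᵢ ℂ (fun x => t⁻¹ * x)
    (measurePreserving_mul_left μ t⁻¹)).toContinuousLinearMap

omit [CompactSpace G] in
theorem coeFn_lpLeftTranslation (t : G) (v : Lp ℂ 1 μ) :
    lpLeftTranslation μ t v =ᵐ[μ] fun x => v (t⁻¹ * x) :=
  Lp.coeFn_compMeasurePreserving v (measurePreserving_mul_left μ t⁻¹)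

omit [CompactSpace G] in
theorem ae_comp_mul_left {p : G → Prop} (h : ∀ᵐ x ∂μ, p x) (t : G) : ∀ᵐ x ∂μ, p (t * x) :=
  (measurePreserving_mul_left μ t).quasiMeasurePreserving.ae h

theorem isContractiveRep_lpLeftTranslation : IsContractiveRep (lpLeftTranslation μ) where
  map_mul s t v := by
    refine Lp.ext ?_
    filter_upwards [coeFn_lpLeftTranslation (s * t) v,
      coeFn_lpLeftTranslation s (lpLeftTranslation μ t v),
      ae_comp_mul_left (coeFn_lpLeftTranslation t v) s⁻¹] with x h1 h2 h3
    rw [h1, h2, h3, mul_inv_rev, mul_assoc]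
  norm_le t v := (LinearIsometry.norm_map _ v).le
  continuous v := by
    let g : C(G, C(G, G)) := ContinuousMap.curry ⟨fun p : G × G => p.1⁻¹ * p.2, by fun_prop⟩
    exact (continuous_const (y := v)).compMeasurePreservingLp g.continuous
      (fun t => measurePreserving_mul_left μ t⁻¹) ENNReal.one_ne_top

theorem toLp_contLeftTranslation (t : G) (k : C(G, ℂ)) :
    ContinuousMap.toLp 1 μ ℂ (contLeftTranslation t k) =
      lpLeftTranslation μ t (ContinuousMap.toLp 1 μ ℂ k) := by
  refine Lp.ext ?_
  filter_upwards [coeFn_lpLeftTranslation t (ContinuousMap.toLp 1 μ ℂ k),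
    ContinuousMap.coeFn_toLp (p := 1) (𝕜 := ℂ) μ (contLeftTranslation t k),
    ae_comp_mul_left (ContinuousMap.coeFn_toLp (p := 1) (𝕜 := ℂ) μ k) t⁻¹] with x h1 h2 h3
  rw [h1, h2, h3, contLeftTranslation_apply]

/-- The integrated form of `f` and the translate of `g` is the translate of the integrated form:
the substitution `y ↦ t y`. -/
theorem IsContractiveRep.integratedForm_lpLeftTranslation {E : Type*} [NormedAddCommGroup E]
    [NormedSpace ℂ E] [CompleteSpace E] {π : G → E →L[ℂ] E} (hπ : IsContractiveRep π) (t : G)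
    (f : Lp ℂ 1 μ) (u : E) :
    integratedForm μ π (lpLeftTranslation μ t f) u = π t (integratedForm μ π f u) := by
  have h1 : π t (integratedForm μ π f u) = ∫ y, f y • π (t * y) u ∂μ := by
    rw [integratedForm, ← (π t).integral_comp_comm (hπ.integrable f u)]
    simp only [map_smul, hπ.map_mul]
  rw [h1, integratedForm,
    ← integral_mul_left_eq_self (fun y => lpLeftTranslation μ t f y • π y u) t]
  refine integral_congr_ae ?_
  filter_upwards [ae_comp_mul_left (coeFn_lpLeftTranslation t f) t] with y hy
  rw [hy, inv_mul_cancel_left]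

/-- The integrated form turns the convolution of `L¹(G)` into the composition of operators. -/
theorem IsContractiveRep.integratedForm_integratedForm {E : Type*} [NormedAddCommGroup E]
    [NormedSpace ℂ E] [CompleteSpace E] {π : G → E →L[ℂ] E} (hπ : IsContractiveRep π)
    (f g : Lp ℂ 1 μ) (u : E) :
    integratedForm μ π (integratedForm μ (lpLeftTranslation μ) f g) u =
      integratedForm μ π f (integratedForm μ π g u) := by
  have h := (hπ.integratedFormCLM μ u).integral_comp_comm
    (isContractiveRep_lpLeftTranslation.integrable f g)
  refine Eq.trans h.symm ?_
  rw [integratedForm]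
  refine integral_congr_ae (ae_of_all _ fun y => ?_)
  dsimp only
  rw [map_smul]
  exact congrArg (f y • ·) (hπ.integratedForm_lpLeftTranslation y g u)

theorem isNormedAlgebraProduct_integratedForm :
    IsNormedAlgebraProduct (integratedForm μ (lpLeftTranslation μ)) where
  add_left := isContractiveRep_lpLeftTranslation.integratedForm_add_left
  add_right := isContractiveRep_lpLeftTranslation.integratedForm_add_right
  smul_left := integratedForm_smul_left
  smul_right c f u := integratedForm_smul_right c f u
  assoc := isContractiveRep_lpLeftTranslation.integratedForm_integratedForm
  norm_le := isContractiveRep_lpLeftTranslation.norm_integratedForm_le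

/-! ### The integrated form on `L¹(G)` is the convolution -/

omit [μ.IsHaarMeasure] in
theorem integratedForm_contLeftTranslation_apply (f : Lp ℂ 1 μ) (k : C(G, ℂ)) (x : G) :
    integratedForm μ contLeftTranslation f k x = ∫ y, f y * k (y⁻¹ * x) ∂μ :=
  ((ContinuousMap.evalCLM ℂ x).integral_comp_comm
    (isContractiveRep_contLeftTranslation.integrable f k)).symm

theorem toLp_integratedForm (f : Lp ℂ 1 μ) (k : C(G, ℂ)) :
    ContinuousMap.toLp 1 μ ℂ (integratedForm μ contLeftTranslation f k) =
      integratedForm μ (lpLeftTranslation μ) f (ContinuousMap.toLp 1 μ ℂ k) :=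
  isContractiveRep_contLeftTranslation.map_integratedForm _
    (fun t k => toLp_contLeftTranslation t k) f k

omit [μ.IsHaarMeasure] in
theorem integrable_mul_comp_inv_mul (f : Lp ℂ 1 μ) (k : C(G, ℂ)) (x : G) :
    Integrable (fun y => f y * k (y⁻¹ * x)) μ :=
  (ContinuousMap.evalCLM ℂ x).integrable_comp
    (isContractiveRep_contLeftTranslation.integrable f k)

/-- For continuous `k`, the function `|f| * |k|` is continuous, and its `L¹` norm is at most
`‖f‖₁ ‖k‖₁`.  This replaces Tonelli's theorem, which does not apply directly because the Borel
sets of `G × G` need not be product-measurable. -/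
theorem exists_continuous_eq_integral_norm (f : Lp ℂ 1 μ) (k : C(G, ℂ)) :
    ∃ h : C(G, ℂ), (∀ x, h x = ((∫ y, ‖f y * k (y⁻¹ * x)‖ ∂μ : ℝ) : ℂ)) ∧
      ‖ContinuousMap.toLp 1 μ ℂ h‖ ≤ ‖f‖ * ‖ContinuousMap.toLp 1 μ ℂ k‖ := by
  have hF : Integrable (fun y => ((‖f y‖ : ℝ) : ℂ)) μ := (L1.integrable_coeFn f).norm.ofReal
  let F : Lp ℂ 1 μ := hF.toL1
  have hFc : F =ᵐ[μ] fun y => ((‖f y‖ : ℝ) : ℂ) := hF.coeFn_toL1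
  let K : C(G, ℂ) := ⟨fun x => ((‖k x‖ : ℝ) : ℂ), by fun_prop⟩
  have hFn : ‖F‖ = ‖f‖ := by
    rw [L1.norm_eq_integral_norm, L1.norm_eq_integral_norm]
    refine integral_congr_ae ?_
    filter_upwards [hFc] with y hy
    simp [hy]
  have hKn : ‖ContinuousMap.toLp 1 μ ℂ K‖ = ‖ContinuousMap.toLp 1 μ ℂ k‖ := by
    rw [L1.norm_eq_integral_norm, L1.norm_eq_integral_norm]
    refine integral_congr_ae ?_
    filter_upwards [ContinuousMap.coeFn_toLp (p := 1) (𝕜 := ℂ) μ k,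
      ContinuousMap.coeFn_toLp (p := 1) (𝕜 := ℂ) μ K] with y hy hy'
    rw [hy, hy']
    simp [K]
  refine ⟨integratedForm μ contLeftTranslation F K, fun x => ?_, ?_⟩
  · rw [integratedForm_contLeftTranslation_apply, ← integral_complex_ofReal]
    refine integral_congr_ae ?_
    filter_upwards [hFc] with y hy
    rw [hy]
    simp [K]
  · rw [toLp_integratedForm, ← hFn, ← hKn]
    exact isContractiveRep_lpLeftTranslation.norm_integratedForm_le _ _

theorem isL1Convolution_integratedForm [IsProbabilityMeasure μ] [T2Space G] (f g : Lp ℂ 1 μ) :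
    IsL1Convolution μ f g (integratedForm μ (lpLeftTranslation μ) f g) := by
  have := isInvInvariant_of_isProbabilityMeasure (μ := μ)
  -- Write `g = ∑ dₙ` with continuous `dₙ` such that `∑ ‖dₙ‖₁ < ∞`.
  obtain ⟨v, hv, hvr, -, hvn⟩ := controlled_sum_of_mem_closure (a := g)
    (s := (ContinuousMap.toLp 1 μ ℂ : C(G, ℂ) →L[ℂ] Lp ℂ 1 μ).range.toAddSubgroup)
    (ContinuousMap.toLp_denseRange ℂ μ ℂ ENNReal.one_ne_top g)
    (b := fun n => (1 / 2 : ℝ) ^ n) (fun n => by positivity)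
  choose d hd using hvr
  have hd' : ∀ n, ContinuousMap.toLp 1 μ ℂ (d n) = v n := hd
  have hvs : Summable fun n => ‖v n‖ := by
    rw [← summable_nat_add_iff 1]
    exact Summable.of_nonneg_of_le (fun n => norm_nonneg _) (fun n => (hvn _ n.succ_pos).le)
      ((summable_nat_add_iff 1).2 summable_geometric_two)
  have hg : HasSum v g := by
    rw [hvs.of_norm.hasSum_iff_tendsto_nat, ← tendsto_add_atTop_iff_nat 1]
    exact hv
  -- The three series below converge in `L¹`, hence almost everywhere.
  have h1 : ∀ᵐ z ∂μ, HasSum (fun n => d n z) (g z) := by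
    have h := Lp.hasSum_coeFn_tsum (f := v) (tsum_enorm_ne_top_iff_summable_norm.2 hvs)
    rw [hg.tsum_eq] at h
    filter_upwards [h, ae_all_iff.2 fun n => ContinuousMap.coeFn_toLp (p := 1) (𝕜 := ℂ) μ (d n)]
      with z hz hz'
    simpa only [← hz', hd'] using hz
  have h2 : ∀ᵐ x ∂μ, HasSum (fun n => ∫ y, f y * d n (y⁻¹ * x) ∂μ)
      (integratedForm μ (lpLeftTranslation μ) f g x) := by
    have hT := (isContractiveRep_lpLeftTranslation.integratedFormCLMRight f).hasSum hg
    have hs : Summable fun n => ‖integratedForm μ (lpLeftTranslation μ) f (v n)‖ :=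
      Summable.of_nonneg_of_le (fun n => norm_nonneg _)
        (fun n => isContractiveRep_lpLeftTranslation.norm_integratedForm_le f (v n))
        (hvs.mul_left _)
    have h := Lp.hasSum_coeFn_tsum (tsum_enorm_ne_top_iff_summable_norm.2 hs)
    have hTe : ∑' n, integratedForm μ (lpLeftTranslation μ) f (v n) =
      integratedForm μ (lpLeftTranslation μ) f g := hT.tsum_eq
    rw [hTe] at h
    filter_upwards [h, ae_all_iff.2 fun n => ContinuousMap.coeFn_toLp (p := 1) (𝕜 := ℂ) μ
      (integratedForm μ contLeftTranslation f (d n))] with x hx hx'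
    simpa only [← integratedForm_contLeftTranslation_apply, ← hx', toLp_integratedForm, hd']
      using hx
  have h3 : ∀ᵐ x ∂μ, Summable fun n => ∫ y, ‖f y * d n (y⁻¹ * x)‖ ∂μ := by
    choose h hh hhn using fun n => exists_continuous_eq_integral_norm f (d n)
    have hs : Summable fun n => ‖ContinuousMap.toLp 1 μ ℂ (h n)‖ :=
      Summable.of_nonneg_of_le (fun n => norm_nonneg _) hhn
        (by simpa only [hd'] using hvs.mul_left _)
    filter_upwards [Lp.hasSum_coeFn_tsum (tsum_enorm_ne_top_iff_summable_norm.2 hs),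
      ae_all_iff.2 fun n => ContinuousMap.coeFn_toLp (p := 1) (𝕜 := ℂ) μ (h n)] with x hx hx'
    have := hx.summable
    simp only [hx', hh] at this
    exact_mod_cast this
  filter_upwards [h2, h3] with x hx2 hx3
  have hq : MeasurePreserving (fun y => y⁻¹ * x) μ μ := by
    have := isMulRightInvariant_of_isProbabilityMeasure (μ := μ)
    exact (measurePreserving_mul_right μ x).comp (Measure.measurePreserving_inv μ)
  have hint : ∀ n, Integrable (fun y => f y * d n (y⁻¹ * x)) μ :=
    fun n => integrable_mul_comp_inv_mul f (d n) x
  have hsum : (fun y => ∑' n, f y * d n (y⁻¹ * x)) =ᵐ[μ] fun y => f y * g (y⁻¹ * x) := by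
    filter_upwards [hq.quasiMeasurePreserving.ae h1] with y hy using (hy.mul_left _).tsum_eq
  refine ⟨⟨(Lp.aestronglyMeasurable f).mul
    ((Lp.aestronglyMeasurable g).comp_measurePreserving hq), ?_⟩, ?_⟩
  · calc ∫⁻ y, ‖f y * g (y⁻¹ * x)‖ₑ ∂μ = ∫⁻ y, ‖∑' n, f y * d n (y⁻¹ * x)‖ₑ ∂μ :=
          lintegral_congr_ae (hsum.symm.mono fun y hy => by simp only [hy])
      _ ≤ ∫⁻ y, ∑' n, ‖f y * d n (y⁻¹ * x)‖ₑ ∂μ := lintegral_mono fun y => enorm_tsum_le_tsum_enorm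
      _ = ∑' n, ∫⁻ y, ‖f y * d n (y⁻¹ * x)‖ₑ ∂μ := lintegral_tsum fun n => (hint n).1.enorm
      _ = ∑' n, ENNReal.ofReal (∫ y, ‖f y * d n (y⁻¹ * x)‖ ∂μ) := by
          simp only [ofReal_integral_norm_eq_lintegral_enorm (hint _)]
      _ < ∞ := hx3.tsum_ofReal_lt_top
  · have h := hasSum_integral_of_summable_integral_norm hint hx3
    rw [integral_congr_ae hsum] at h
    exact hx2.unique h

end Translation

/-! ### Continuity of translation in the Luxemburg and Orlicz norms -/

section TranslationContinuity

variable {G : Type*} [Group G] [TopologicalSpace G] [IsTopologicalGroup G] [CompactSpace G]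
    [MeasurableSpace G] [BorelSpace G] {Φ : ℝ → ℝ} {μ : Measure G} [μ.IsHaarMeasure]

theorem tendsto_lintegral_translate_sub {f : G → ℂ} (hf : Integrable f μ) (s : G) :
    Tendsto (fun t => ∫⁻ x, ‖f (t⁻¹ * x) - f (s⁻¹ * x)‖ₑ ∂μ) (𝓝 s) (𝓝 0) := by
  have h : Tendsto (fun t => ‖lpLeftTranslation μ t hf.toL1 - lpLeftTranslation μ s hf.toL1‖ₑ)
      (𝓝 s) (𝓝 0) := by
    have := ((isContractiveRep_lpLeftTranslation (μ := μ)).continuous hf.toL1).tendsto s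
    have := (this.sub_const (lpLeftTranslation μ s hf.toL1)).enorm
    simpa using this
  refine h.congr fun t => ?_
  rw [Lp.enorm_def, eLpNorm_one_eq_lintegral_enorm]
  refine lintegral_congr_ae ?_
  have hc (r : G) : lpLeftTranslation μ r hf.toL1 =ᵐ[μ] fun x => f (r⁻¹ * x) := by
    filter_upwards [coeFn_lpLeftTranslation r hf.toL1, ae_comp_mul_left hf.coeFn_toL1 r⁻¹]
      with x h1 h2
    rw [h1, h2]
  filter_upwards [Lp.coeFn_sub (lpLeftTranslation μ t hf.toL1) (lpLeftTranslation μ s hf.toL1),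
    hc t, hc s] with x h1 h2 h3
  rw [h1, Pi.sub_apply, h2, h3]

theorem tendsto_modular_translate_sub (hΦ : IsYoungFunction Φ) {f : G → ℂ}
    (hf : AEStronglyMeasurable f μ) {B : ℝ} (hB : ∀ x, ‖f x‖ ≤ B) (s : G) :
    Tendsto (fun t => modular Φ μ (fun x => f (t⁻¹ * x) - f (s⁻¹ * x))) (𝓝 s) (𝓝 0) := by
  have hint : Integrable f μ := .of_bound hf B (ae_of_all _ hB)
  have hB0 : 0 ≤ B := (norm_nonneg _).trans (hB 1)
  have h := ENNReal.Tendsto.const_mul (a := ENNReal.ofReal (Φ (2 * B + 1) / (2 * B + 1)))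
    (tendsto_lintegral_translate_sub hint s) (Or.inr ENNReal.ofReal_ne_top)
  rw [mul_zero] at h
  refine tendsto_of_tendsto_of_tendsto_of_le_of_le tendsto_const_nhds h (fun _ => zero_le)
    fun t => modular_le_of_bounded hΦ (by positivity) fun x => ?_
  exact (norm_sub_le _ _).trans (by linarith [hB (t⁻¹ * x), hB (s⁻¹ * x)])

/-- Translation is continuous on `M^Φ`: by truncation this reduces to bounded functions, for which
the modular is dominated by the `L¹` norm. -/
theorem MemMorseTransue.tendsto_luxemburgNorm_translate_sub (hΦ : IsYoungFunction Φ) {f : G → ℂ}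
    (hf : MemMorseTransue Φ μ f) (s : G) :
    Tendsto (fun t => luxemburgNorm Φ μ (fun x => f (t⁻¹ * x) - f (s⁻¹ * x))) (𝓝 s) (𝓝 0) := by
  refine ENNReal.tendsto_nhds_zero.2 fun ε hε => ?_
  obtain ⟨δ, hδ, hδε⟩ : ∃ δ : ℝ, 0 < δ ∧ ENNReal.ofReal (3 * δ) ≤ ε := by
    obtain ⟨r, hr, hrε⟩ := ENNReal.lt_iff_exists_nnreal_btwn.1 hε
    refine ⟨r / 3, by have : (0 : ℝ) < r := by exact_mod_cast hr
                      positivity, ?_⟩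
    rw [mul_div_cancel₀ _ (by norm_num), ENNReal.ofReal_coe_nnreal]
    exact hrε.le
  obtain ⟨g, hg, ⟨B, hB⟩, hfg⟩ := hf.exists_bounded_luxemburgNorm_sub_le hΦ hδ
  have hlim := tendsto_modular_translate_sub (f := fun x => g x / (δ : ℂ)) (B := B / δ) hΦ
    (by simpa only [div_eq_mul_inv] using hg.mul_const _)
    (fun x => by
      rw [norm_div, Complex.norm_real, Real.norm_of_nonneg hδ.le]
      gcongr
      exact hB x) s
  filter_upwards [hlim.eventually (ge_mem_nhds one_pos)] with t ht
  have h1 : luxemburgNorm Φ μ (fun x => g (t⁻¹ * x) - g (s⁻¹ * x)) ≤ ENNReal.ofReal δ :=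
    luxemburgNorm_le_of_modular_le hδ (by simpa only [sub_div] using ht)
  have hd (r : G) : luxemburgNorm Φ μ (fun x => f (r⁻¹ * x) - g (r⁻¹ * x)) ≤ ENNReal.ofReal δ :=
    (luxemburgNorm_comp_mul_left (fun x => f x - g x) r⁻¹).trans_le hfg
  have hm (r : G) : AEStronglyMeasurable (fun x => f (r⁻¹ * x) - g (r⁻¹ * x)) μ :=
    aestronglyMeasurable_comp_mul_left (hf.1.sub hg) r⁻¹
  have h2 := luxemburgNorm_add_le hΦ (hm t) (fun x => -(f (s⁻¹ * x) - g (s⁻¹ * x)))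
  rw [luxemburgNorm_neg (fun x => f (s⁻¹ * x) - g (s⁻¹ * x))] at h2
  have h3 := luxemburgNorm_add_le hΦ ((hm t).add (hm s).neg) (fun x => g (t⁻¹ * x) - g (s⁻¹ * x))
  calc luxemburgNorm Φ μ (fun x => f (t⁻¹ * x) - f (s⁻¹ * x))
      = _ := by
        congr 1
        ext x
        simp only [Pi.add_apply, Pi.neg_apply]
        ring
    _ ≤ _ := h3
    _ ≤ (ENNReal.ofReal δ + ENNReal.ofReal δ) + ENNReal.ofReal δ := by
        gcongr
        exact h2.trans (add_le_add (hd t) (hd s))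
    _ = ENNReal.ofReal (3 * δ) := by
        rw [← ENNReal.ofReal_add hδ.le hδ.le, ← ENNReal.ofReal_add (by positivity) hδ.le]
        congr 1; ring
    _ ≤ ε := hδε

theorem MemMorseTransue.tendsto_complementaryOrliczNorm_translate_sub (hΦ : IsNFunction Φ)
    {g : G → ℂ} (hg : MemMorseTransue (complementary Φ) μ g) (s : G) :
    Tendsto (fun t => complementaryOrliczNorm Φ μ (fun x => g (t⁻¹ * x) - g (s⁻¹ * x)))
      (𝓝 s) (𝓝 0) := by
  have h := ENNReal.Tendsto.const_mul (a := 4)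
    (hg.tendsto_luxemburgNorm_translate_sub hΦ.isYoungFunction_complementary s)
    (Or.inr (by simp))
  rw [mul_zero] at h
  exact tendsto_of_tendsto_of_tendsto_of_le_of_le tendsto_const_nhds h (fun _ => zero_le)
    fun t => complementaryOrliczNorm_le hΦ _

/-- Dominated convergence for series, along an arbitrary filter. -/
theorem ENNReal.tendsto_tsum_zero_of_dominated {α : Type*} {l : Filter α} {F : α → ℕ → ℝ≥0∞}
    {b : ℕ → ℝ≥0∞} (hb : ∑' n, b n ≠ ∞) (hF : ∀ a n, F a n ≤ b n)
    (h : ∀ n, Tendsto (fun a => F a n) l (𝓝 0)) :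
    Tendsto (fun a => ∑' n, F a n) l (𝓝 0) := by
  have hb' : ∀ n, b n ≠ ∞ := ENNReal.ne_top_of_tsum_ne_top hb
  have hF' : ∀ a n, F a n ≠ ∞ := fun a n => ne_top_of_le_ne_top (hb' n) (hF a n)
  have hs : ∀ a, ∑' n, F a n ≠ ∞ := fun a =>
    ne_top_of_le_ne_top hb (ENNReal.tsum_le_tsum (hF a))
  rw [← ENNReal.tendsto_toReal_iff hs ENNReal.zero_ne_top]
  simp only [ENNReal.tsum_toReal_eq (hF' _)]
  have := tendsto_tsum_of_dominated_convergence (𝓕 := l) (f := fun a n => (F a n).toReal)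
    (g := fun _ => (0 : ℝ)) (ENNReal.summable_toReal hb)
    (fun n => by simpa [Function.comp_def] using (ENNReal.tendsto_toReal ENNReal.zero_ne_top).comp (h n))
    (.of_forall fun a n => by
      rw [Real.norm_of_nonneg ENNReal.toReal_nonneg]
      exact ENNReal.toReal_mono (hb' n) (hF a n))
  simpa using this

end TranslationContinuity

/-! ### Representations `u = ∑ fₙ * ǧₙ` -/

section Representation

variable {G : Type*} [Group G] [MeasurableSpace G] [MeasurableMul G] {Φ : ℝ → ℝ}
    {μ : Measure G} [μ.IsMulLeftInvariant]

omit [MeasurableMul G] [μ.IsMulLeftInvariant] in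
theorem groupConv_inv_apply (f g : G → ℂ) (x : G) :
    groupConv μ f (fun z => g z⁻¹) x = ∫ y, f y * g (x⁻¹ * y) ∂μ := by
  simp [groupConv]

/-- Hölder's inequality for the integrand of `(f * ǧ)(x)`. -/
theorem lintegral_mul_translate_le (hΦ : IsNFunction Φ) {f g : G → ℂ}
    (hf : MemMorseTransue Φ μ f) (hg : MemMorseTransue (complementary Φ) μ g) (x : G) :
    ∫⁻ y, ‖f y * g (x⁻¹ * y)‖ₑ ∂μ ≤ luxemburgNorm Φ μ f * complementaryOrliczNorm Φ μ g := by
  rw [← complementaryOrliczNorm_comp_mul_left g x⁻¹]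
  exact lintegral_mul_le_luxemburgNorm_mul hΦ.isYoungFunction hf.1
    (hf.luxemburgNorm_lt_top hΦ.isYoungFunction).ne
    ((hg.comp_mul_left x⁻¹).complementaryOrliczNorm_lt_top hΦ).ne

theorem integrable_mul_translate (hΦ : IsNFunction Φ) {f g : G → ℂ}
    (hf : MemMorseTransue Φ μ f) (hg : MemMorseTransue (complementary Φ) μ g) (x : G) :
    Integrable (fun y => f y * g (x⁻¹ * y)) μ :=
  ⟨hf.1.mul (hg.comp_mul_left x⁻¹).1, (lintegral_mul_translate_le hΦ hf hg x).trans_lt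
    (ENNReal.mul_lt_top (hf.luxemburgNorm_lt_top hΦ.isYoungFunction)
      (hg.complementaryOrliczNorm_lt_top hΦ))⟩

theorem enorm_groupConv_le (hΦ : IsNFunction Φ) {f g : G → ℂ}
    (hf : MemMorseTransue Φ μ f) (hg : MemMorseTransue (complementary Φ) μ g) (x : G) :
    ‖groupConv μ f (fun z => g z⁻¹) x‖ₑ ≤
      luxemburgNorm Φ μ f * complementaryOrliczNorm Φ μ g := by
  rw [groupConv_inv_apply]
  exact (enorm_integral_le_lintegral_enorm _).trans (lintegral_mul_translate_le hΦ hf hg x)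

theorem groupConv_comp_mul_left (f g : G → ℂ) (t x : G) :
    groupConv μ (fun y => f (t⁻¹ * y)) (fun z => g z⁻¹) x =
      groupConv μ f (fun z => g z⁻¹) (t⁻¹ * x) := by
  rw [groupConv_inv_apply, groupConv_inv_apply,
    ← integral_mul_left_eq_self (fun y => f (t⁻¹ * y) * g (x⁻¹ * y)) t]
  simp [mul_assoc]

omit [MeasurableMul G] [μ.IsMulLeftInvariant] in
theorem groupConv_comp_mul_left_right (f g : G → ℂ) (t x : G) :
    groupConv μ f (fun z => g (t⁻¹ * z⁻¹)) x = groupConv μ f (fun z => g z⁻¹) (x * t) := by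
  rw [groupConv_inv_apply f g, groupConv_inv_apply f (fun z => g (t⁻¹ * z))]
  simp [mul_assoc]

namespace IsRepresentation

variable {u v : G → ℂ} {f g f' g' : ℕ → G → ℂ}

theorem enorm_apply_le (hΦ : IsNFunction Φ) (h : IsRepresentation Φ μ u f g) (x : G) :
    ‖u x‖ₑ ≤ seriesCost Φ μ f g := by
  rw [← (h.hasSum x).tsum_eq]
  exact enorm_tsum_le_tsum_enorm.trans
    (ENNReal.tsum_le_tsum fun n => enorm_groupConv_le hΦ (h.mem_left n) (h.mem_right n) x)

omit [MeasurableMul G] [μ.IsMulLeftInvariant] in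
theorem const_mul (hΦ : IsNFunction Φ) (c : ℂ) (h : IsRepresentation Φ μ u f g) :
    IsRepresentation Φ μ (fun x => c * u x) (fun n x => c * f n x) g ∧
      seriesCost Φ μ (fun n x => c * f n x) g ≤ ‖c‖ₑ * seriesCost Φ μ f g := by
  have hc : seriesCost Φ μ (fun n x => c * f n x) g ≤ ‖c‖ₑ * seriesCost Φ μ f g := by
    rw [seriesCost, seriesCost, ← ENNReal.tsum_mul_left]
    refine ENNReal.tsum_le_tsum fun n => ?_
    rw [← mul_assoc]
    gcongr
    exact luxemburgNorm_const_mul_le hΦ.isYoungFunction c (f n)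
  refine ⟨⟨fun n => (h.mem_left n).const_mul hΦ.isYoungFunction c, h.mem_right,
    hc.trans_lt (ENNReal.mul_lt_top (by simp) h.cost_lt_top), fun x => ?_⟩, hc⟩
  convert! (h.hasSum x).mul_left c using 2 with n
  rw [groupConv, groupConv, ← integral_const_mul]
  simp only [mul_assoc]

theorem translate_left (h : IsRepresentation Φ μ u f g) (t : G) :
    IsRepresentation Φ μ (fun x => u (t⁻¹ * x)) (fun n x => f n (t⁻¹ * x)) g ∧
      seriesCost Φ μ (fun n x => f n (t⁻¹ * x)) g = seriesCost Φ μ f g := by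
  have hc : seriesCost Φ μ (fun n x => f n (t⁻¹ * x)) g = seriesCost Φ μ f g := by
    simp only [seriesCost, luxemburgNorm_comp_mul_left (f _)]
  refine ⟨⟨fun n => (h.mem_left n).comp_mul_left t⁻¹, h.mem_right, hc ▸ h.cost_lt_top,
    fun x => ?_⟩, hc⟩
  simpa only [groupConv_comp_mul_left] using h.hasSum (t⁻¹ * x)

theorem translate_right (h : IsRepresentation Φ μ u f g) (t : G) :
    IsRepresentation Φ μ (fun x => u (x * t)) f (fun n x => g n (t⁻¹ * x)) ∧
      seriesCost Φ μ f (fun n x => g n (t⁻¹ * x)) = seriesCost Φ μ f g := by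
  have hc : seriesCost Φ μ f (fun n x => g n (t⁻¹ * x)) = seriesCost Φ μ f g := by
    simp only [seriesCost, complementaryOrliczNorm_comp_mul_left (g _)]
  refine ⟨⟨h.mem_left, fun n => (h.mem_right n).comp_mul_left t⁻¹, hc ▸ h.cost_lt_top,
    fun x => ?_⟩, hc⟩
  simpa only [groupConv_comp_mul_left_right] using h.hasSum (x * t)

theorem sub_left (hΦ : IsNFunction Φ) (h : IsRepresentation Φ μ u f g)
    (h' : IsRepresentation Φ μ v f' g) :
    IsRepresentation Φ μ (fun x => u x - v x) (fun n x => f n x - f' n x) g where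
  mem_left n := (h.mem_left n).sub hΦ.isYoungFunction (h'.mem_left n)
  mem_right := h.mem_right
  cost_lt_top := by
    refine lt_of_le_of_lt ?_ (ENNReal.add_lt_top.2 ⟨h.cost_lt_top, h'.cost_lt_top⟩)
    rw [seriesCost, seriesCost, seriesCost, ← ENNReal.tsum_add]
    refine ENNReal.tsum_le_tsum fun n => ?_
    rw [← add_mul]
    gcongr
    simpa only [sub_eq_add_neg, luxemburgNorm_neg (f' n)] using
      luxemburgNorm_add_le hΦ.isYoungFunction (h.mem_left n).1 (fun x => -f' n x)
  hasSum x := by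
    convert! (h.hasSum x).sub (h'.hasSum x) using 2 with n
    rw [groupConv_inv_apply, groupConv_inv_apply, groupConv_inv_apply,
      ← integral_sub (integrable_mul_translate hΦ (h.mem_left n) (h.mem_right n) x)
        (integrable_mul_translate hΦ (h'.mem_left n) (h.mem_right n) x)]
    simp only [sub_mul]

theorem sub_right (hΦ : IsNFunction Φ) (h : IsRepresentation Φ μ u f g)
    (h' : IsRepresentation Φ μ v f g') :
    IsRepresentation Φ μ (fun x => u x - v x) f (fun n x => g n x - g' n x) where
  mem_left := h.mem_left
  mem_right n := (h.mem_right n).sub hΦ.isYoungFunction_complementary (h'.mem_right n)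
  cost_lt_top := by
    refine lt_of_le_of_lt ?_ (ENNReal.add_lt_top.2 ⟨h.cost_lt_top, h'.cost_lt_top⟩)
    rw [seriesCost, seriesCost, seriesCost, ← ENNReal.tsum_add]
    refine ENNReal.tsum_le_tsum fun n => ?_
    rw [← mul_add]
    gcongr
    simpa only [sub_eq_add_neg, complementaryOrliczNorm_neg (g' n)] using
      complementaryOrliczNorm_add_le (h.mem_right n).1 (fun x => -g' n x)
  hasSum x := by
    convert! (h.hasSum x).sub (h'.hasSum x) using 2 with n
    refine (groupConv_inv_apply (f n) (fun z => g n z - g' n z) x).trans ?_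
    rw [groupConv_inv_apply, groupConv_inv_apply,
      ← integral_sub (integrable_mul_translate hΦ (h.mem_left n) (h.mem_right n) x)
        (integrable_mul_translate hΦ (h.mem_left n) (h'.mem_right n) x)]
    simp only [mul_sub]

end IsRepresentation

end Representation

/-! ### The Banach space `A_Φ(G)` -/

section FigaTalamancaHerzOrliczSpace

variable {G : Type*} [Group G] [TopologicalSpace G] [MeasurableSpace G] {Φ : ℝ → ℝ}
    {μ : Measure G}

theorem figaHerzOrliczNorm_le {u : C₀(G, ℂ)} {f g : ℕ → G → ℂ}
    (h : IsRepresentation Φ μ u f g) : figaHerzOrliczNorm Φ μ u ≤ seriesCost Φ μ f g :=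
  iInf_le_of_le f <| iInf_le_of_le g <| iInf_le _ h

theorem exists_seriesCost_lt {u : C₀(G, ℂ)} {a : ℝ≥0∞} (h : figaHerzOrliczNorm Φ μ u < a) :
    ∃ f g, IsRepresentation Φ μ u f g ∧ seriesCost Φ μ f g < a := by
  simpa only [figaHerzOrliczNorm, iInf_lt_iff, exists_prop] using h

theorem figaHerzOrliczNorm_lt_top {u : C₀(G, ℂ)} (hu : u ∈ figaHerzOrlicz Φ μ) :
    figaHerzOrliczNorm Φ μ u < ∞ := by
  obtain ⟨f, g, h⟩ := hu
  exact (figaHerzOrliczNorm_le h).trans_lt h.cost_lt_top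

theorem figaHerzOrliczNorm_smul_le (hΦ : IsNFunction Φ) (c : ℂ) {u : C₀(G, ℂ)}
    (hu : u ∈ figaHerzOrlicz Φ μ) :
    c • u ∈ figaHerzOrlicz Φ μ ∧
      figaHerzOrliczNorm Φ μ (c • u) ≤ ‖c‖ₑ * figaHerzOrliczNorm Φ μ u := by
  have key {f g : ℕ → G → ℂ} (h : IsRepresentation Φ μ u f g) :
      figaHerzOrliczNorm Φ μ (c • u) ≤ ‖c‖ₑ * seriesCost Φ μ f g :=
    (figaHerzOrliczNorm_le (u := c • u) (h.const_mul hΦ c).1).trans (h.const_mul hΦ c).2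
  obtain ⟨f, g, h⟩ := hu
  refine ⟨⟨_, _, (h.const_mul hΦ c).1⟩, ?_⟩
  rcases eq_or_ne c 0 with rfl | hc
  · simpa using key h
  have hc0 : ‖c‖ₑ ≠ 0 := by simpa using hc
  rw [mul_comm, ← ENNReal.div_le_iff hc0 enorm_ne_top]
  refine le_iInf fun f => le_iInf fun g => le_iInf fun h => ?_
  rw [ENNReal.div_le_iff hc0 enorm_ne_top, mul_comm]
  exact key h

theorem figaHerzOrlicz_zero (hΦ : IsNFunction Φ) :
    (0 : C₀(G, ℂ)) ∈ figaHerzOrlicz Φ μ := by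
  have h0 {Θ : ℝ → ℝ} (hΘ : IsYoungFunction Θ) : MemMorseTransue Θ μ fun _ => 0 :=
    ⟨aestronglyMeasurable_const, fun a _ => by simp [modular, hΘ.map_zero]⟩
  refine ⟨fun _ _ => 0, fun _ _ => 0, fun _ => h0 hΦ.isYoungFunction,
    fun _ => h0 hΦ.isYoungFunction_complementary, ?_, fun x => ?_⟩
  · simp [seriesCost, complementaryOrliczNorm_zero]
  · simp [groupConv]

theorem mem_figaHerzOrlicz_of_eq_groupConv (hΦ : IsNFunction Φ) {u : C₀(G, ℂ)} {f g : G → ℂ}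
    (hf : MemMorseTransue Φ μ f) (hg : MemMorseTransue (complementary Φ) μ g)
    (h : ∀ x, u x = groupConv μ f (fun z => g z⁻¹) x) : u ∈ figaHerzOrlicz Φ μ := by
  refine ⟨fun n => if n = 0 then f else fun x => 0 * f x,
    fun _ => g, fun n => ?_, fun _ => hg, ?_, fun x => ?_⟩
  · split_ifs
    · exact hf
    · exact hf.const_mul hΦ.isYoungFunction 0
  · rw [seriesCost, tsum_eq_single 0]
    · exact ENNReal.mul_lt_top (hf.luxemburgNorm_lt_top hΦ.isYoungFunction)
        (hg.complementaryOrliczNorm_lt_top hΦ)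
    · intro n hn
      simp [hn, luxemburgNorm_zero hΦ.isYoungFunction]
  · rw [h]
    convert! hasSum_single (f := fun n => groupConv μ (if n = 0 then f else fun x => 0 * f x)
      (fun z => g z⁻¹) x) 0 ?_ using 1
    intro n hn
    simp [hn, groupConv]

variable [MeasurableMul G] [μ.IsMulLeftInvariant]

theorem enorm_apply_le_figaHerzOrliczNorm (hΦ : IsNFunction Φ) (u : C₀(G, ℂ)) (x : G) :
    ‖u x‖ₑ ≤ figaHerzOrliczNorm Φ μ u :=
  le_iInf fun _ => le_iInf fun _ => le_iInf fun h => h.enorm_apply_le hΦ x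

/-- Countable subadditivity of `‖·‖_{A_Φ}`: almost optimal representations of the terms of a series
combine to a representation of its sum.  This gives both the triangle inequality and
completeness. -/
theorem figaHerzOrlicz_hasSum (hΦ : IsNFunction Φ) {ι : Type*} [Countable ι] [Nonempty ι]
    {u : ι → C₀(G, ℂ)} {w : C₀(G, ℂ)} (hw : ∀ x, HasSum (fun i => u i x) (w x))
    (hfin : ∑' i, figaHerzOrliczNorm Φ μ (u i) ≠ ∞) :
    w ∈ figaHerzOrlicz Φ μ ∧
      figaHerzOrliczNorm Φ μ w ≤ ∑' i, figaHerzOrliczNorm Φ μ (u i) := by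
  have key : ∀ ε : NNReal, 0 < ε → ∃ f g, IsRepresentation Φ μ w f g ∧
      seriesCost Φ μ f g ≤ ∑' i, figaHerzOrliczNorm Φ μ (u i) + ε := by
    intro ε hε
    obtain ⟨δ, hδ, hδε⟩ := ENNReal.exists_pos_sum_of_countable
      (ENNReal.coe_ne_zero.2 hε.ne') ι
    have hlt (i : ι) : figaHerzOrliczNorm Φ μ (u i) < figaHerzOrliczNorm Φ μ (u i) + δ i :=
      ENNReal.lt_add_right (ENNReal.ne_top_of_tsum_ne_top hfin i)
        (ENNReal.coe_ne_zero.2 (hδ i).ne')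
    choose f g hrep hcost using fun i => exists_seriesCost_lt (hlt i)
    obtain ⟨e⟩ : Nonempty (ℕ ≃ ι × ℕ) := nonempty_equiv_of_countable
    let c : ι × ℕ → ℝ≥0∞ := fun p =>
      luxemburgNorm Φ μ (f p.1 p.2) * complementaryOrliczNorm Φ μ (g p.1 p.2)
    have hc : ∑' p, c p ≤ ∑' i, figaHerzOrliczNorm Φ μ (u i) + ε := by
      rw [ENNReal.tsum_prod']
      calc ∑' i, ∑' n, c (i, n) ≤ ∑' i, (figaHerzOrliczNorm Φ μ (u i) + δ i) :=
            ENNReal.tsum_le_tsum fun i => (hcost i).le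
        _ = ∑' i, figaHerzOrliczNorm Φ μ (u i) + ∑' i, (δ i : ℝ≥0∞) := ENNReal.tsum_add
        _ ≤ _ := by gcongr
    have hcfin : ∑' p, c p < ∞ :=
      hc.trans_lt (ENNReal.add_lt_top.2 ⟨hfin.lt_top, ENNReal.coe_lt_top⟩)
    have hce : seriesCost Φ μ (fun n => f (e n).1 (e n).2) (fun n => g (e n).1 (e n).2) =
        ∑' p, c p := e.tsum_eq c
    refine ⟨fun n => f (e n).1 (e n).2, fun n => g (e n).1 (e n).2,
      ⟨fun n => (hrep _).mem_left _, fun n => (hrep _).mem_right _, hce ▸ hcfin, fun x => ?_⟩,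
      hce.trans_le hc⟩
    let F : ι × ℕ → ℂ := fun p => groupConv μ (f p.1 p.2) (fun z => g p.1 p.2 z⁻¹) x
    have hF : Summable F := Summable.of_enorm (ne_top_of_le_ne_top hcfin.ne
      (ENNReal.tsum_le_tsum fun p =>
        enorm_groupConv_le hΦ ((hrep _).mem_left _) ((hrep _).mem_right _) x))
    have hFw : ∑' p, F p = w x :=
      (hF.hasSum.prod_fiberwise fun i => (hrep i).hasSum x).unique (hw x)
    exact e.hasSum_iff.2 (hFw ▸ hF.hasSum)
  refine ⟨?_, ENNReal.le_of_forall_pos_le_add fun ε hε _ => ?_⟩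
  · obtain ⟨f, g, h, -⟩ := key 1 one_pos
    exact ⟨f, g, h⟩
  · obtain ⟨f, g, h, hc⟩ := key ε hε
    exact (figaHerzOrliczNorm_le h).trans hc

theorem figaHerzOrliczNorm_add_le (hΦ : IsNFunction Φ) {u v : C₀(G, ℂ)}
    (hu : u ∈ figaHerzOrlicz Φ μ) (hv : v ∈ figaHerzOrlicz Φ μ) :
    u + v ∈ figaHerzOrlicz Φ μ ∧ figaHerzOrliczNorm Φ μ (u + v) ≤
      figaHerzOrliczNorm Φ μ u + figaHerzOrliczNorm Φ μ v := by
  have h := figaHerzOrlicz_hasSum (μ := μ) hΦ (ι := Bool) (u := fun b => cond b u v)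
    (w := u + v) (fun x => by
      convert! hasSum_fintype (fun b : Bool => (cond b u v : C₀(G, ℂ)) x) using 1
      simp) (by
      rw [tsum_fintype, Fintype.sum_bool]
      exact (ENNReal.add_lt_top.2 ⟨figaHerzOrliczNorm_lt_top hu, figaHerzOrliczNorm_lt_top hv⟩).ne)
  rwa [tsum_fintype, Fintype.sum_bool] at h

/-- `A_Φ(G)` as a linear subspace of `C₀(G)`. -/
def figaHerzOrliczSubmodule (hΦ : IsNFunction Φ) (μ : Measure G) [μ.IsMulLeftInvariant] :
    Submodule ℂ C₀(G, ℂ) where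
  carrier := figaHerzOrlicz Φ μ
  add_mem' hu hv := (figaHerzOrliczNorm_add_le hΦ hu hv).1
  zero_mem' := figaHerzOrlicz_zero hΦ
  smul_mem' c _ hu := (figaHerzOrliczNorm_smul_le hΦ c hu).1

/-- The space `A_Φ(G)` with its own norm.  It is a type synonym of a subspace of `C₀(G)`, so that it
does not inherit the supremum norm. -/
def FigaHerzOrliczSpace (hΦ : IsNFunction Φ) (μ : Measure G) [μ.IsMulLeftInvariant] : Type _ :=
  figaHerzOrliczSubmodule hΦ μ

namespace FigaHerzOrliczSpace

variable {hΦ : IsNFunction Φ}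

noncomputable instance : AddCommGroup (FigaHerzOrliczSpace hΦ μ) :=
  inferInstanceAs (AddCommGroup (figaHerzOrliczSubmodule hΦ μ))

noncomputable instance : Module ℂ (FigaHerzOrliczSpace hΦ μ) :=
  inferInstanceAs (Module ℂ (figaHerzOrliczSubmodule hΦ μ))

/-- The inclusion of `A_Φ(G)` in `C₀(G)`. -/
noncomputable def toC₀ : FigaHerzOrliczSpace hΦ μ →ₗ[ℂ] C₀(G, ℂ) := (figaHerzOrliczSubmodule hΦ μ).subtype

theorem toC₀_mem (u : FigaHerzOrliczSpace hΦ μ) : u.toC₀ ∈ figaHerzOrlicz Φ μ :=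
  Subtype.property (p := (· ∈ figaHerzOrliczSubmodule hΦ μ)) u

theorem toC₀_injective : Function.Injective (toC₀ (hΦ := hΦ) (μ := μ)) :=
  Subtype.val_injective

theorem exists_toC₀_eq {u : C₀(G, ℂ)} (hu : u ∈ figaHerzOrlicz Φ μ) :
    ∃ v : FigaHerzOrliczSpace hΦ μ, v.toC₀ = u :=
  ⟨(⟨u, hu⟩ : figaHerzOrliczSubmodule hΦ μ), rfl⟩

noncomputable instance : Norm (FigaHerzOrliczSpace hΦ μ) :=
  ⟨fun u => (figaHerzOrliczNorm Φ μ u.toC₀).toReal⟩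

theorem norm_def (u : FigaHerzOrliczSpace hΦ μ) :
    ‖u‖ = (figaHerzOrliczNorm Φ μ u.toC₀).toReal := rfl

theorem ofReal_norm_eq (u : FigaHerzOrliczSpace hΦ μ) :
    ENNReal.ofReal ‖u‖ = figaHerzOrliczNorm Φ μ u.toC₀ :=
  ENNReal.ofReal_toReal (figaHerzOrliczNorm_lt_top u.toC₀_mem).ne

theorem norm_apply_le (u : FigaHerzOrliczSpace hΦ μ) (x : G) : ‖u.toC₀ x‖ ≤ ‖u‖ := by
  have h := enorm_apply_le_figaHerzOrliczNorm (μ := μ) hΦ u.toC₀ x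
  rw [← ofReal_norm_eq, ← ofReal_norm] at h
  exact (ENNReal.ofReal_le_ofReal_iff ENNReal.toReal_nonneg).1 h

theorem norm_smul_le_aux (c : ℂ) (u : FigaHerzOrliczSpace hΦ μ) : ‖c • u‖ ≤ ‖c‖ * ‖u‖ := by
  have h := (figaHerzOrliczNorm_smul_le hΦ c u.toC₀_mem).2
  rw [← map_smul, ← ofReal_norm_eq, ← ofReal_norm_eq, ← ofReal_norm,
    ← ENNReal.ofReal_mul (norm_nonneg _)] at h
  exact (ENNReal.ofReal_le_ofReal_iff
    (mul_nonneg (norm_nonneg _) ENNReal.toReal_nonneg)).1 h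

theorem core : NormedSpace.Core ℂ (FigaHerzOrliczSpace hΦ μ) where
  norm_nonneg _ := ENNReal.toReal_nonneg
  norm_smul c u := by
    refine le_antisymm (norm_smul_le_aux c u) ?_
    rcases eq_or_ne c 0 with rfl | hc
    · rw [norm_zero, zero_mul]; exact ENNReal.toReal_nonneg
    have h := norm_smul_le_aux c⁻¹ (c • u)
    rwa [inv_smul_smul₀ hc, norm_inv, inv_mul_eq_div, le_div_iff₀' (norm_pos_iff.2 hc)] at h
  norm_triangle u v := by
    have h := (figaHerzOrliczNorm_add_le hΦ u.toC₀_mem v.toC₀_mem).2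
    have hu : (0 : ℝ) ≤ ‖u‖ := ENNReal.toReal_nonneg
    have hv : (0 : ℝ) ≤ ‖v‖ := ENNReal.toReal_nonneg
    rw [← map_add, ← ofReal_norm_eq, ← ofReal_norm_eq, ← ofReal_norm_eq,
      ← ENNReal.ofReal_add hu hv] at h
    exact (ENNReal.ofReal_le_ofReal_iff (add_nonneg hu hv)).1 h
  norm_eq_zero_iff u := by
    constructor
    · intro h
      refine toC₀_injective (ZeroAtInftyContinuousMap.ext fun x => ?_)
      have := norm_apply_le u x
      rw [h] at this
      simpa using this
    · rintro rfl
      have := norm_smul_le_aux (0 : ℂ) (0 : FigaHerzOrliczSpace hΦ μ)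
      rw [norm_zero, zero_mul, smul_zero] at this
      exact le_antisymm this ENNReal.toReal_nonneg

noncomputable instance : NormedAddCommGroup (FigaHerzOrliczSpace hΦ μ) :=
  NormedAddCommGroup.ofCore core

noncomputable instance : NormedSpace ℂ (FigaHerzOrliczSpace hΦ μ) :=
  NormedSpace.ofCore core

/-- The norm of `A_Φ(G)` bounds the supremum norm. -/
theorem norm_toC₀_le (u : FigaHerzOrliczSpace hΦ μ) : ‖u.toC₀‖ ≤ ‖u‖ := by
  rw [← ZeroAtInftyContinuousMap.norm_toBCF_eq_norm,
    BoundedContinuousFunction.norm_le (norm_nonneg u)]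
  exact u.norm_apply_le

instance : CompleteSpace (FigaHerzOrliczSpace hΦ μ) := by
  refine NormedAddCommGroup.completeSpace_of_summable_imp_tendsto fun u hu => ?_
  -- The series converges uniformly, to `w` say.
  have hs : Summable fun n => (u n).toC₀ :=
    Summable.of_norm (Summable.of_nonneg_of_le (fun n => norm_nonneg _)
      (fun n => (u n).norm_toC₀_le) hu)
  have happ (x : G) {f : ℕ → C₀(G, ℂ)} {w : C₀(G, ℂ)} (h : HasSum f w) :
      HasSum (fun n => f n x) (w x) := by
    let ev : C₀(G, ℂ) →+ ℂ := ⟨⟨fun k => k x, rfl⟩, fun _ _ => rfl⟩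
    have hev : Continuous ev := (BoundedContinuousFunction.evalCLM ℂ x).continuous.comp
      (ZeroAtInftyContinuousMap.isometry_toBCF (α := G) (β := ℂ)).continuous
    exact h.map ev hev
  -- Every tail of the series converges in `A_Φ`, and its sum is bounded by the tail of `∑ ‖uₙ‖`.
  have htail (N : ℕ) {w : C₀(G, ℂ)} (hw : HasSum (fun n => (u (n + N)).toC₀) w) :
      w ∈ figaHerzOrlicz Φ μ ∧
        figaHerzOrliczNorm Φ μ w ≤ ENNReal.ofReal (∑' n, ‖u (n + N)‖) := by
    have hN := (summable_nat_add_iff N).2 hu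
    have h := figaHerzOrlicz_hasSum (μ := μ) hΦ (fun x => happ x hw) (by
      simp only [← ofReal_norm_eq]
      exact hN.tsum_ofReal_ne_top)
    simp only [← ofReal_norm_eq] at h
    rwa [ENNReal.ofReal_tsum_of_nonneg (fun n => norm_nonneg _) hN]
  obtain ⟨v, hv⟩ := exists_toC₀_eq (hΦ := hΦ) (htail 0 hs.hasSum).1
  refine ⟨v, ?_⟩
  rw [tendsto_iff_norm_sub_tendsto_zero]
  refine squeeze_zero (fun _ => norm_nonneg _) (fun N => ?_) (tendsto_sum_nat_add fun n => ‖u n‖)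
  have hw : HasSum (fun n => (u (n + N)).toC₀) (v - ∑ i ∈ Finset.range N, u i).toC₀ := by
    rw [map_sub, map_sum, hv]
    exact (hasSum_nat_add_iff' N).2 hs.hasSum
  have h := (htail N hw).2
  rw [← ofReal_norm_eq] at h
  rw [norm_sub_rev]
  exact (ENNReal.ofReal_le_ofReal_iff (tsum_nonneg fun n => norm_nonneg _)).1 h

end FigaHerzOrliczSpace

end FigaTalamancaHerzOrliczSpace

/-! ### Translations on `A_Φ(G)` -/

namespace FigaHerzOrliczSpace

section Translation

variable {G : Type*} [Group G] [TopologicalSpace G] [IsTopologicalGroup G] [CompactSpace G]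
    [MeasurableSpace G] [BorelSpace G] {μ : Measure G} [μ.IsHaarMeasure] {Φ : ℝ → ℝ}
    {hΦ : IsNFunction Φ}

theorem exists_leftTranslation (t : G) (u : FigaHerzOrliczSpace hΦ μ) :
    ∃ v : FigaHerzOrliczSpace hΦ μ, ∀ x, v.toC₀ x = u.toC₀ (t⁻¹ * x) := by
  obtain ⟨f, g, h⟩ := u.toC₀_mem
  let w : C₀(G, ℂ) := ZeroAtInftyContinuousMap.ContinuousMap.liftZeroAtInfty
    (u.toC₀.toContinuousMap.comp ⟨fun x => t⁻¹ * x, continuous_const_mul _⟩)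
  obtain ⟨v, hv⟩ := exists_toC₀_eq (hΦ := hΦ) (μ := μ) (u := w) ⟨_, _, (h.translate_left t).1⟩
  exact ⟨v, fun x => by rw [hv]; rfl⟩

theorem exists_rightTranslation (t : G) (u : FigaHerzOrliczSpace hΦ μ) :
    ∃ v : FigaHerzOrliczSpace hΦ μ, ∀ x, v.toC₀ x = u.toC₀ (x * t) := by
  obtain ⟨f, g, h⟩ := u.toC₀_mem
  let w : C₀(G, ℂ) := ZeroAtInftyContinuousMap.ContinuousMap.liftZeroAtInfty
    (u.toC₀.toContinuousMap.comp ⟨fun x => x * t, continuous_mul_const _⟩)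
  obtain ⟨v, hv⟩ := exists_toC₀_eq (hΦ := hΦ) (μ := μ) (u := w) ⟨_, _, (h.translate_right t).1⟩
  exact ⟨v, fun x => by rw [hv]; rfl⟩

/-- Right translation `(R_t u)(x) = u(x t)` on `A_Φ(G)`. -/
noncomputable def rightTranslation (t : G) (u : FigaHerzOrliczSpace hΦ μ) :
    FigaHerzOrliczSpace hΦ μ :=
  (exists_rightTranslation t u).choose

theorem toC₀_rightTranslation (t : G) (u : FigaHerzOrliczSpace hΦ μ) (x : G) :
    (rightTranslation t u).toC₀ x = u.toC₀ (x * t) :=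
  (exists_rightTranslation t u).choose_spec x

omit [CompactSpace G] in
theorem ext_apply {u v : FigaHerzOrliczSpace hΦ μ} (h : ∀ x, u.toC₀ x = v.toC₀ x) : u = v :=
  toC₀_injective (ZeroAtInftyContinuousMap.ext h)

omit [CompactSpace G] in
/-- Translating a representation of `u` gives one of the translate of `u`, of the same cost. -/
theorem norm_le_norm_of_translate_left {t : G} {u v : FigaHerzOrliczSpace hΦ μ}
    (h : ∀ x, v.toC₀ x = u.toC₀ (t⁻¹ * x)) : ‖v‖ ≤ ‖u‖ := by
  refine ENNReal.toReal_mono (figaHerzOrliczNorm_lt_top u.toC₀_mem).ne ?_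
  refine le_iInf fun f => le_iInf fun g => le_iInf fun hr => ?_
  obtain ⟨h1, h2⟩ := hr.translate_left t
  rw [← h2]
  refine figaHerzOrliczNorm_le ?_
  rwa [show (v.toC₀ : G → ℂ) = fun x => u.toC₀ (t⁻¹ * x) from funext h]

/-- Left translation `(L_t u)(x) = u(t⁻¹ x)` on `A_Φ(G)`. -/
noncomputable def leftTranslation (t : G) :
    FigaHerzOrliczSpace hΦ μ →L[ℂ] FigaHerzOrliczSpace hΦ μ :=
  LinearMap.mkContinuous
    { toFun := fun u => (exists_leftTranslation t u).choose
      map_add' := fun u v => ext_apply fun x => by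
        refine ((exists_leftTranslation t (u + v)).choose_spec x).trans ?_
        simp only [map_add, ZeroAtInftyContinuousMap.add_apply]
        rw [(exists_leftTranslation t u).choose_spec, (exists_leftTranslation t v).choose_spec]
      map_smul' := fun c u => ext_apply fun x => by
        refine ((exists_leftTranslation t (c • u)).choose_spec x).trans ?_
        simp only [RingHom.id_apply, map_smul, ZeroAtInftyContinuousMap.smul_apply]
        rw [(exists_leftTranslation t u).choose_spec] } 1 fun u => by
    rw [one_mul]
    exact norm_le_norm_of_translate_left (exists_leftTranslation t u).choose_spec

theorem toC₀_leftTranslation (t : G) (u : FigaHerzOrliczSpace hΦ μ) (x : G) :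
    (leftTranslation t u).toC₀ x = u.toC₀ (t⁻¹ * x) :=
  (exists_leftTranslation t u).choose_spec x

omit [CompactSpace G] in
/-- A map into `A_Φ(G)` converges if the differences have representations whose costs tend to
`0`. -/
theorem tendsto_of_isRepresentation {α : Type*} {l : Filter α} {v : α → FigaHerzOrliczSpace hΦ μ}
    {w : FigaHerzOrliczSpace hΦ μ} {f g : α → ℕ → G → ℂ}
    (h : ∀ a, IsRepresentation Φ μ (fun x => (v a).toC₀ x - w.toC₀ x) (f a) (g a))
    (hlim : Tendsto (fun a => seriesCost Φ μ (f a) (g a)) l (𝓝 0)) : Tendsto v l (𝓝 w) := by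
  rw [tendsto_iff_norm_sub_tendsto_zero]
  have h0 := (ENNReal.tendsto_toReal ENNReal.zero_ne_top).comp hlim
  refine squeeze_zero (fun _ => norm_nonneg _) (fun a => ?_) h0
  refine ENNReal.toReal_mono (h a).cost_lt_top.ne (figaHerzOrliczNorm_le ?_)
  rw [map_sub]
  exact h a

theorem continuous_leftTranslation (u : FigaHerzOrliczSpace hΦ μ) :
    Continuous fun t => leftTranslation t u := by
  refine continuous_iff_continuousAt.2 fun s => ?_
  obtain ⟨f, g, h⟩ := u.toC₀_mem
  refine tendsto_of_isRepresentation (f := fun t n x => f n (t⁻¹ * x) - f n (s⁻¹ * x))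
    (g := fun _ => g) (fun t => ?_) ?_
  · simp only [toC₀_leftTranslation]
    exact (h.translate_left t).1.sub_left hΦ (h.translate_left s).1
  · refine ENNReal.tendsto_tsum_zero_of_dominated
      (b := fun n => 2 * (luxemburgNorm Φ μ (f n) * complementaryOrliczNorm Φ μ (g n))) ?_
      (fun t n => ?_) fun n => ?_
    · rw [ENNReal.tsum_mul_left]
      exact ENNReal.mul_ne_top (by simp) h.cost_lt_top.ne
    · rw [← mul_assoc, two_mul]
      gcongr
      have := luxemburgNorm_add_le hΦ.isYoungFunction ((h.mem_left n).comp_mul_left t⁻¹).1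
        (fun x => -f n (s⁻¹ * x))
      rw [luxemburgNorm_neg (fun x => f n (s⁻¹ * x)), luxemburgNorm_comp_mul_left,
        luxemburgNorm_comp_mul_left] at this
      simpa only [sub_eq_add_neg] using this
    · have := ENNReal.Tendsto.mul_const
        ((h.mem_left n).tendsto_luxemburgNorm_translate_sub hΦ.isYoungFunction s)
        (Or.inr ((h.mem_right n).complementaryOrliczNorm_lt_top hΦ).ne)
      rwa [zero_mul] at this

theorem continuous_rightTranslation (u : FigaHerzOrliczSpace hΦ μ) :
    Continuous fun t => rightTranslation t u := by
  refine continuous_iff_continuousAt.2 fun s => ?_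
  obtain ⟨f, g, h⟩ := u.toC₀_mem
  refine tendsto_of_isRepresentation (f := fun _ => f)
    (g := fun t n x => g n (t⁻¹ * x) - g n (s⁻¹ * x)) (fun t => ?_) ?_
  · simp only [toC₀_rightTranslation]
    exact (h.translate_right t).1.sub_right hΦ (h.translate_right s).1
  · refine ENNReal.tendsto_tsum_zero_of_dominated
      (b := fun n => 2 * (luxemburgNorm Φ μ (f n) * complementaryOrliczNorm Φ μ (g n))) ?_
      (fun t n => ?_) fun n => ?_
    · rw [ENNReal.tsum_mul_left]
      exact ENNReal.mul_ne_top (by simp) h.cost_lt_top.ne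
    · rw [mul_left_comm, two_mul]
      gcongr
      have := complementaryOrliczNorm_add_le (Φ := Φ) ((h.mem_right n).comp_mul_left t⁻¹).1
        (fun x => -g n (s⁻¹ * x))
      rw [complementaryOrliczNorm_neg (fun x => g n (s⁻¹ * x)),
        complementaryOrliczNorm_comp_mul_left, complementaryOrliczNorm_comp_mul_left] at this
      simpa only [sub_eq_add_neg] using this
    · have := ENNReal.Tendsto.const_mul
        ((h.mem_right n).tendsto_complementaryOrliczNorm_translate_sub hΦ s)
        (Or.inr ((h.mem_left n).luxemburgNorm_lt_top hΦ.isYoungFunction).ne)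
      rwa [mul_zero] at this

theorem isContractiveRep_leftTranslation :
    IsContractiveRep (leftTranslation (hΦ := hΦ) (μ := μ)) where
  map_mul s t u := ext_apply fun x => by
    rw [toC₀_leftTranslation, toC₀_leftTranslation, toC₀_leftTranslation, mul_inv_rev, mul_assoc]
  norm_le t u := norm_le_norm_of_translate_left (toC₀_leftTranslation t u)
  continuous := continuous_leftTranslation

end Translation

/-! ### The embedding of `A_Φ(G)` into `L¹(G)` -/

section Embedding

variable {G : Type*} [Group G] [TopologicalSpace G] [IsTopologicalGroup G] [CompactSpace G]
    [MeasurableSpace G] [BorelSpace G] {μ : Measure G} [μ.IsHaarMeasure]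
    [IsProbabilityMeasure μ] {Φ : ℝ → ℝ} {hΦ : IsNFunction Φ}

/-- The embedding of `A_Φ(G)` into `L¹(G)`. -/
noncomputable def toL1 : FigaHerzOrliczSpace hΦ μ →L[ℂ] Lp ℂ 1 μ :=
  LinearMap.mkContinuous
    { toFun := fun u => ContinuousMap.toLp 1 μ ℂ u.toC₀.toContinuousMap
      map_add' := fun u v => by rw [← map_add]; rfl
      map_smul' := fun c u => by rw [← map_smul]; rfl } 1 fun u => by
    have h1 : ‖(ContinuousMap.toLp 1 μ ℂ : C(G, ℂ) →L[ℂ] Lp ℂ 1 μ)‖ ≤ 1 := by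
      simpa [measureUnivNNReal] using ContinuousMap.toLp_norm_le (p := 1) (E := ℂ) (𝕜 := ℂ) μ
    refine (ContinuousLinearMap.le_opNorm _ _).trans (mul_le_mul h1 ?_ (norm_nonneg _) zero_le_one)
    rw [ContinuousMap.norm_le _ (norm_nonneg u)]
    exact u.norm_apply_le

theorem norm_toL1_le (u : FigaHerzOrliczSpace hΦ μ) : ‖toL1 u‖ ≤ ‖u‖ := by
  have := (toL1 (hΦ := hΦ) (μ := μ)).le_of_opNorm_le
    (LinearMap.mkContinuous_norm_le _ zero_le_one _) u
  rwa [one_mul] at this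

theorem coeFn_toL1 (u : FigaHerzOrliczSpace hΦ μ) : toL1 u =ᵐ[μ] u.toC₀ :=
  ContinuousMap.coeFn_toLp (p := 1) (𝕜 := ℂ) μ u.toC₀.toContinuousMap

theorem eq_toL1 {u : FigaHerzOrliczSpace hΦ μ} {v : Lp ℂ 1 μ} (h : v =ᵐ[μ] u.toC₀) :
    v = toL1 u :=
  Lp.ext (h.trans (coeFn_toL1 u).symm)

/-- Haar measure is positive on nonempty open sets, so an element of `L¹(G)` has at most one
continuous representative. -/
theorem toC₀_eq_of_ae_eq {u : FigaHerzOrliczSpace hΦ μ} {w : C₀(G, ℂ)} (h : toL1 u =ᵐ[μ] w) :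
    w = u.toC₀ := by
  refine ZeroAtInftyContinuousMap.ext fun x => ?_
  have := (w.continuous.ae_eq_iff_eq μ u.toC₀.continuous).1 (h.symm.trans (coeFn_toL1 u))
  exact congrFun this x

theorem toL1_injective : Function.Injective (toL1 (hΦ := hΦ) (μ := μ)) := fun u v h =>
  toC₀_injective (toC₀_eq_of_ae_eq (by rw [← h]; exact coeFn_toL1 u))

variable (hΦ μ) in
theorem range_toL1 : Set.range (toL1 (hΦ := hΦ) (μ := μ)) = figaHerzOrliczL1 Φ μ := by
  ext v
  constructor
  · rintro ⟨u, rfl⟩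
    exact ⟨u.toC₀, u.toC₀_mem, coeFn_toL1 u⟩
  · rintro ⟨w, hw, hv⟩
    obtain ⟨u, rfl⟩ := exists_toC₀_eq (hΦ := hΦ) hw
    exact ⟨u, (eq_toL1 hv).symm⟩

theorem figaHerzOrliczL1Norm_toL1 (u : FigaHerzOrliczSpace hΦ μ) :
    figaHerzOrliczL1Norm Φ μ (toL1 u) = ‖u‖ := by
  rw [figaHerzOrliczL1Norm, norm_def]
  congr 1
  refine le_antisymm (iInf_le_of_le u.toC₀ <| iInf_le_of_le u.toC₀_mem <|
    iInf_le _ (coeFn_toL1 u)) ?_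
  refine le_iInf fun w => le_iInf fun _ => le_iInf fun h => ?_
  rw [toC₀_eq_of_ae_eq h]

theorem coeFn_toL1_leftTranslation (t : G) (u : FigaHerzOrliczSpace hΦ μ) :
    toL1 (leftTranslation t u) =ᵐ[μ] fun x => toL1 u (t⁻¹ * x) := by
  filter_upwards [coeFn_toL1 (leftTranslation t u), ae_comp_mul_left (coeFn_toL1 u) t⁻¹]
    with x h1 h2
  rw [h1, h2, toC₀_leftTranslation]

theorem coeFn_toL1_rightTranslation (t : G) (u : FigaHerzOrliczSpace hΦ μ) :
    toL1 (rightTranslation t u) =ᵐ[μ] fun x => toL1 u (x * t) := by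
  have := isMulRightInvariant_of_isProbabilityMeasure (μ := μ)
  filter_upwards [coeFn_toL1 (rightTranslation t u),
    (measurePreserving_mul_right μ t).quasiMeasurePreserving.ae (coeFn_toL1 u)] with x h1 h2
  rw [h1, h2, toC₀_rightTranslation]

theorem toL1_integratedForm (f : Lp ℂ 1 μ) (u : FigaHerzOrliczSpace hΦ μ) :
    toL1 (integratedForm μ leftTranslation f u) =
      integratedForm μ (lpLeftTranslation μ) f (toL1 u) :=
  isContractiveRep_leftTranslation.map_integratedForm toL1 (fun t u => Lp.ext <|
    (coeFn_toL1_leftTranslation t u).trans (coeFn_lpLeftTranslation t (toL1 u)).symm) f u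

/-- `A_Φ(G)` is dense in `L¹(G)`: a continuous `k` is approximated in `L¹` by the averages of its
translates `L_y k` over small neighbourhoods `U` of `1`, and this average is the convolution of the
bounded function `1_U / μ(U)` with the continuous function `k`. -/
theorem denseRange_toL1 [T2Space G] : DenseRange (toL1 (hΦ := hΦ) (μ := μ)) := by
  refine Dense.of_closure ((ContinuousMap.toLp_denseRange ℂ μ ℂ ENNReal.one_ne_top).mono ?_)
  rintro _ ⟨k, rfl⟩
  set K : Lp ℂ 1 μ := ContinuousMap.toLp 1 μ ℂ k
  refine Metric.mem_closure_iff.2 fun ε hε => ?_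
  have hcont := (isContractiveRep_lpLeftTranslation (μ := μ)).continuous K
  set U : Set G := {y | lpLeftTranslation μ y K ∈ Metric.ball K (ε / 2)}
  have hU : IsOpen U := Metric.isOpen_ball.preimage hcont
  have h1U : (1 : G) ∈ U := by
    have h1 : lpLeftTranslation μ 1 K = K := Lp.ext <| by
      filter_upwards [coeFn_lpLeftTranslation 1 K] with x hx
      rw [hx, inv_one, one_mul]
    change lpLeftTranslation μ 1 K ∈ Metric.ball K (ε / 2)
    rw [h1]
    exact Metric.mem_ball_self (half_pos hε)
  have hU0 : μ U ≠ 0 := (hU.measure_pos μ ⟨1, h1U⟩).ne'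
  have hUt : μ U ≠ ∞ := measure_ne_top μ U
  let c : ℂ := (((μ.real U)⁻¹ : ℝ) : ℂ)
  let e : Lp ℂ 1 μ := indicatorConstLp 1 hU.measurableSet hUt c
  have he : e =ᵐ[μ] U.indicator fun _ => c := indicatorConstLp_coeFn
  -- `e * k` belongs to `A_Φ`.
  let q : C₀(G, ℂ) := ZeroAtInftyContinuousMap.ContinuousMap.liftZeroAtInfty (integratedForm μ contLeftTranslation e k)
  have hq : q ∈ figaHerzOrlicz Φ μ := by
    refine mem_figaHerzOrlicz_of_eq_groupConv (g := fun x => k x⁻¹) hΦ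
      (memMorseTransue_of_bounded hΦ.isYoungFunction
        (aestronglyMeasurable_const.indicator hU.measurableSet) (B := ‖c‖)
        (norm_indicator_le_norm_self (s := U) (fun _ => c)))
      (memMorseTransue_of_bounded hΦ.isYoungFunction_complementary
        (by fun_prop : Continuous fun x => k x⁻¹).aestronglyMeasurable_of_compactSpace
        fun x => k.norm_coe_le_norm _) fun x => ?_
    refine (integratedForm_contLeftTranslation_apply e k x).trans ?_
    simp only [groupConv, inv_inv]
    exact integral_congr_ae (he.mono fun y hy => by simp only [hy])
  obtain ⟨u, hu⟩ := exists_toC₀_eq (hΦ := hΦ) hq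
  refine ⟨toL1 u, ⟨u, rfl⟩, ?_⟩
  -- `e * k` is the average of the translates of `k` over `U`.
  have hue : toL1 u = ⨍ y in U, lpLeftTranslation μ y K ∂μ := by
    calc toL1 u = ContinuousMap.toLp 1 μ ℂ u.toC₀.toContinuousMap := rfl
      _ = ContinuousMap.toLp 1 μ ℂ (integratedForm μ contLeftTranslation e k) := by rw [hu]; rfl
      _ = ∫ y, e y • lpLeftTranslation μ y K ∂μ := toLp_integratedForm e k
      _ = ∫ y, U.indicator (fun y => (μ.real U)⁻¹ • lpLeftTranslation μ y K) y ∂μ := by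
          refine integral_congr_ae (he.mono fun y hy => ?_)
          dsimp only
          rw [hy]
          by_cases hyU : y ∈ U
          · rw [Set.indicator_of_mem hyU, Set.indicator_of_mem hyU]
            exact Complex.coe_smul _ _
          · rw [Set.indicator_of_notMem hyU, Set.indicator_of_notMem hyU, zero_smul]
      _ = _ := by rw [integral_indicator hU.measurableSet, integral_smul, setAverage_eq]
  have hmem : (⨍ y in U, lpLeftTranslation μ y K ∂μ) ∈ Metric.closedBall K (ε / 2) := by
    refine (convex_closedBall K (ε / 2)).set_average_mem Metric.isClosed_closedBall hU0 hUt
      ((ae_restrict_mem hU.measurableSet).mono fun y hy => Metric.ball_subset_closedBall hy) ?_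
    exact (Integrable.of_bound hcont.aestronglyMeasurable_of_compactSpace ‖K‖
      (ae_of_all _ fun y => isContractiveRep_lpLeftTranslation.norm_le y K)).integrableOn
  rw [dist_comm, hue]
  exact (Metric.mem_closedBall.1 hmem).trans_lt (half_lt_self hε)

end Embedding

end FigaHerzOrliczSpace

/-- The image of a Banach space under an injective linear map is a Banach subspace for the
transported norm. -/
theorem isBanachSubspace_range {A E : Type*} [AddCommGroup A] [Module ℂ A] [NormedAddCommGroup E]
    [NormedSpace ℂ E] [CompleteSpace E] {T : E →ₗ[ℂ] A} (hT : Function.Injective T) {N : A → ℝ}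
    (hN : ∀ u, N (T u) = ‖u‖) : IsBanachSubspace (Set.range T) N where
  zero_mem := ⟨0, map_zero T⟩
  add_mem := by
    rintro _ ⟨u, rfl⟩ _ ⟨v, rfl⟩
    exact ⟨u + v, map_add T u v⟩
  smul_mem := by
    rintro c _ ⟨u, rfl⟩
    exact ⟨c • u, map_smul T c u⟩
  norm_nonneg := by
    rintro _ ⟨u, rfl⟩
    exact hN u ▸ norm_nonneg u
  norm_eq_zero := by
    rintro _ ⟨u, rfl⟩
    rw [hN, norm_eq_zero, map_eq_zero_iff T hT]
  norm_add_le := by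
    rintro _ ⟨u, rfl⟩ _ ⟨v, rfl⟩
    rw [← map_add, hN, hN, hN]
    exact norm_add_le u v
  norm_smul := by
    rintro c _ ⟨u, rfl⟩
    rw [← map_smul, hN, hN, norm_smul]
  complete a ha hc := by
    choose u hu using ha
    obtain rfl : (fun n => T (u n)) = a := funext hu
    have hcs : CauchySeq u := Metric.cauchySeq_iff.2 fun ε hε => by
      obtain ⟨n₀, h⟩ := hc ε hε
      refine ⟨n₀, fun m hm n hn => ?_⟩
      have := h m hm n hn
      rwa [← map_sub, hN, ← dist_eq_norm] at this
    obtain ⟨v, hv⟩ := cauchySeq_tendsto_of_complete hcs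
    refine ⟨T v, ⟨v, rfl⟩, ?_⟩
    simp only [← map_sub, hN]
    exact tendsto_iff_norm_sub_tendsto_zero.1 hv

open FigaHerzOrliczSpace in
theorem theorem3p5 {G : Type*} [Group G] [TopologicalSpace G] [IsTopologicalGroup G] [T2Space G]
    [CompactSpace G] [MeasurableSpace G] [BorelSpace G]
    (μ : Measure G) [μ.IsHaarMeasure] [IsProbabilityMeasure μ]
    (Φ : ℝ → ℝ) (hΦ : IsNFunction Φ) :
    IsSymmetricSegalAlgebra μ (figaHerzOrliczL1 Φ μ) (figaHerzOrliczL1Norm Φ μ) ∧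
    ∃ mul : Lp ℂ 1 μ → Lp ℂ 1 μ → Lp ℂ 1 μ,
      (∀ f g, IsL1Convolution μ f g (mul f g)) ∧
      IsAbstractSegalAlgebra mul (figaHerzOrliczL1 Φ μ) (figaHerzOrliczL1Norm Φ μ) := by
  rw [← range_toL1 μ hΦ]
  have hdense : Dense (Set.range (toL1 (hΦ := hΦ) (μ := μ))) := denseRange_toL1
  have hbanach : IsBanachSubspace (Set.range (toL1 (hΦ := hΦ) (μ := μ)))
      (figaHerzOrliczL1Norm Φ μ) :=
    isBanachSubspace_range (T := (toL1 (hΦ := hΦ) (μ := μ)).toLinearMap) toL1_injective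
      figaHerzOrliczL1Norm_toL1
  have hle : ∀ v ∈ Set.range (toL1 (hΦ := hΦ) (μ := μ)), ‖v‖ ≤ figaHerzOrliczL1Norm Φ μ v := by
    rintro _ ⟨u, rfl⟩
    exact (norm_toL1_le u).trans_eq (figaHerzOrliczL1Norm_toL1 u).symm
  have hmul : ∀ (a : Lp ℂ 1 μ), ∀ b ∈ Set.range (toL1 (hΦ := hΦ) (μ := μ)),
      figaHerzOrliczL1Norm Φ μ (integratedForm μ (lpLeftTranslation μ) a b) ≤
        ‖a‖ * figaHerzOrliczL1Norm Φ μ b := by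
    rintro a _ ⟨u, rfl⟩
    rw [← toL1_integratedForm, figaHerzOrliczL1Norm_toL1, figaHerzOrliczL1Norm_toL1]
    exact isContractiveRep_leftTranslation.norm_integratedForm_le a u
  refine ⟨⟨⟨hdense, hbanach, hle, ?_⟩, ?_⟩, integratedForm μ (lpLeftTranslation μ),
    isL1Convolution_integratedForm, ?_⟩
  · rintro _ ⟨u, rfl⟩
    refine ⟨fun t => toL1 (leftTranslation t u),
      fun t => ⟨⟨_, rfl⟩, coeFn_toL1_leftTranslation t u⟩, fun s => ?_⟩
    simp only [← map_sub, figaHerzOrliczL1Norm_toL1]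
    exact tendsto_iff_norm_sub_tendsto_zero.1 ((continuous_leftTranslation u).tendsto s)
  · rintro _ ⟨u, rfl⟩
    refine ⟨fun t => toL1 (rightTranslation t u),
      fun t => ⟨⟨_, rfl⟩, coeFn_toL1_rightTranslation t u⟩, fun s => ?_⟩
    simp only [← map_sub, figaHerzOrliczL1Norm_toL1]
    exact tendsto_iff_norm_sub_tendsto_zero.1 ((continuous_rightTranslation u).tendsto s)
  · exact
      { product := isNormedAlgebraProduct_integratedForm
        complete := inferInstance
        dense := hdense
        banach := hbanach
        mul_mem := by
          rintro a _ ⟨u, rfl⟩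
          exact ⟨_, toL1_integratedForm a u⟩
        norm_mul_le := fun a ha b hb => (hmul a b hb).trans
          (mul_le_mul_of_nonneg_right (hle a ha) (hbanach.norm_nonneg b hb))
        norm_le := ⟨1, one_pos, fun b hb => by simpa using hle b hb⟩
        norm_mul_le' := ⟨1, one_pos, fun a b hb => by simpa using hmul a b hb⟩ }
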